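/- Let $K,m_1,m_2,n_1,n_2,s_1,s_2$ and $l_1,l_{2,i}$ ($i\in[K]=\{1,\dots,K\}$) be natural numbers (the dimensions), and let $p_i\ge 0$ with $\sum_{i=1}^K p_i=1$. Write $\mathbf{x}_{\mathbf y}=(x;y_1;\dots;y_K)\in\mathbb{R}^{m_1}\times(\mathbb{R}^{m_2})^K$ and put $$\hat f(\mathbf{x}_{\mathbf y})=c(x)+\sum_{i=1}^K p_i q_i(y_i),\qquad \mathcal U(\mathbf{x}_{\mathbf y})=(U_1x+u_1;\,V_iy_i+v_i,\ i\in[K]),$$ $$P(w;w_1,\dots,w_K)=P_1(w)+\sum_{i=1}^K p_iP_{2,i}(w_i),\qquad \Psi=P\circ\mathcal U,$$ $$G(\mathbf{x}_{\mathbf y})=\big(Ax-a;\ Bx-b;\ A_{1,i}y_i+A_{2,i}x-d_i,\ i\in[K];\ W_iy_i+T_ix-h_i,\ i\in[K]\big),$$ $$\mathcal K=\{0_{n_1}\}\times(-C_1)\times\{0_{n_2}\}^K\times\prod_{i=1}^K(-C_{2,i}),$$ where all matrices and vectors are real and given, $Ax-a\in\mathbb{R}^{n_1}$, $Bx-b\in\mathbb{R}^{s_1}$,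 $A_{1,i}y_i+A_{2,i}x-d_i\in\mathbb{R}^{n_2}$, $W_iy_i+T_ix-h_i\in\mathbb{R}^{s_2}$, $U_1x+u_1\in\mathbb{R}^{l_1}$, $V_iy_i+v_i\in\mathbb{R}^{l_{2,i}}$; $C_1\subseteq\mathbb{R}^{s_1}$ and $C_{2,i}\subseteq\mathbb{R}^{s_2}$ are closed convex cones with nonempty interior (for example second-order cones, nonnegative orthants, cones of positive semidefinite matrices, and products of these); $c:\mathbb{R}^{m_1}\to\mathbb{R}$ and $q_i:\mathbb{R}^{m_2}\to\mathbb{R}$ are convex and twice continuously differentiable; $P_1:\mathbb{R}^{l_1}\to\mathbb{R}$ and $P_{2,i}:\mathbb{R}^{l_{2,i}}\to\mathbb{R}$ are lower semicontinuous and bounded below. Consider $$\min\ \hat f(\mathbf{x}_{\mathbf y})+\Psi(\mathbf{x}_{\mathbf y})\quad\text{s.t.}\quad G(\mathbf{x}_{\mathbf y})\in\mathcal K,\tag{P}$$ with feasible set $\Phi=\{\mathbf{x}_{\mathbf y}: G(\mathbf{x}_{\mathbf y})\in\mathcal K\}$. Below, $\partial$ and $\partial^\infty$ denote the limiting (Mordukhovich)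 and the horizon subdifferential, $N_{\mathcal K}$ the limiting normal cone, $\mathcal J L$ the Jacobian and $\nabla L=(\mathcal J L)^T$. *RCQ.* For a differentiable mapping $H=(H^1;H^2;H^{1,i},i\in[K];H^{2,i},i\in[K])$ on a Euclidean space, partitioned as $G$ is, the Robinson constraint qualification (RCQ) holds at $w$ for the system $H(\cdot)\in\mathcal K$ if $H(w)\in\mathcal K$, the gradients at $w$ of all the components of $H^1$ and of $H^{1,i}$, $i\in[K]$, are linearly independent, and there is a $d$ with $\mathcal JH^1(w)d=0$, $\mathcal JH^{1,i}(w)d=0$, $H^2(w)+\mathcal JH^2(w)d\in\operatorname{int}(-C_1)$ and $H^{2,i}(w)+\mathcal JH^{2,i}(w)d\in\operatorname{int}(-C_{2,i})$ for all $i\in[K]$. *KKT point.* $\mathbf{x}^*_{\mathbf y}$ is a KKT point of (P) if $\mathbf{x}^*_{\mathbf y}\in\Phi$ and there are $\lambda^*\in\partial P(\mathcal U(\mathbf{x}^*_{\mathbf y}))$ and $M^*\in N_{\mathcal K}(G(\mathbf{x}^*_{\mathbf y}))$ with $$0=\nabla\hat f(\mathbf{x}^*_{\mathbf y})+\nabla\mathcal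 U(\mathbf{x}^*_{\mathbf y})\lambda^*+\nabla G(\mathbf{x}^*_{\mathbf y})M^*.$$ **Statement.** Let $\mathbf{x}^*_{\mathbf y}$ be a local minimizer of (P). Suppose that $\Psi(\mathbf{x}_{\mathbf y})=\sum_{j=1}^{m_1+m_2K}\psi_j((\mathbf{x}_{\mathbf y})_j)$ for all $\mathbf{x}_{\mathbf y}$, with lower semicontinuous functions $\psi_j:\mathbb{R}\to\mathbb{R}$. Let $\mathcal I=\{j:\partial^\infty\psi_j((\mathbf{x}^*_{\mathbf y})_j)=\{0\}\}$ and let $\mathcal I^c$ be its complement in the set of all coordinates. Suppose that $\partial\psi_j((\mathbf{x}^*_{\mathbf y})_j)=\mathbb{R}$ for every $j\in\mathcal I^c$, and that the RCQ holds at $(\mathbf{x}^*_{\mathbf y})_{\mathcal I}$ for the system $G\big((\mathbf{x}_{\mathbf y})_{\mathcal I},(\mathbf{x}^*_{\mathbf y})_{\mathcal I^c}\big)\in\mathcal K$ in the variable $(\mathbf{x}_{\mathbf y})_{\mathcal I}$. Then: 1. $\mathbf{x}^*_{\mathbf y}$ is a stationary point of (P): $\mathbf{x}^*_{\mathbf y}\in\Phi$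 and $$0\in\nabla\hat f(\mathbf{x}^*_{\mathbf y})+\partial\Psi(\mathbf{x}^*_{\mathbf y})+\nabla G(\mathbf{x}^*_{\mathbf y})N_{\mathcal K}(G(\mathbf{x}^*_{\mathbf y})).$$ 2. If moreover $U_1$ and all $V_i$ have full row rank (in particular if $\mathcal U$ is the identity, so that $P=\Psi$), then $\mathbf{x}^*_{\mathbf y}$ is a KKT point of (P). -/

import Mathlib

open Filter Topology

noncomputable section

namespace TwoStage

/-! ### Variational analysis -/

section Variational

variable {E : Type*} [NormedAddCommGroup E] [InnerProductSpace ℝ E]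

/-- Fréchet (regular) subdifferential of a real-valued function. The lower limit is taken in
the extended reals. -/
def frechetSubdiff (f : E → ℝ) (x : E) : Set E :=
  {v | (0 : EReal) ≤ liminf
    (fun w => (((f w - f x - inner ℝ v (w - x)) / ‖w - x‖ : ℝ) : EReal)) (𝓝[≠] x)}

/-- Limiting (Mordukhovich) subdifferential of a real-valued function. -/
def limitingSubdiff (f : E → ℝ) (x : E) : Set E :=
  {v | ∃ (w : ℕ → E) (g : ℕ → E),
    Tendsto w atTop (𝓝 x) ∧ Tendsto (fun k => f (w k)) atTop (𝓝 (f x)) ∧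
    (∀ k, g k ∈ frechetSubdiff f (w k)) ∧ Tendsto g atTop (𝓝 v)}

/-- Horizon subdifferential of a real-valued function. -/
def horizonSubdiff (f : E → ℝ) (x : E) : Set E :=
  {v | ∃ (w : ℕ → E) (g : ℕ → E) (α : ℕ → ℝ),
    Tendsto w atTop (𝓝 x) ∧ Tendsto (fun k => f (w k)) atTop (𝓝 (f x)) ∧
    (∀ k, 0 < α k) ∧ Tendsto α atTop (𝓝 0) ∧
    (∀ k, g k ∈ frechetSubdiff f (w k)) ∧ Tendsto (fun k => α k • g k) atTop (𝓝 v)}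

/-- Regular (Fréchet) normal cone of a set at one of its points. -/
def regularNormalCone (S : Set E) (x : E) : Set E :=
  {v | x ∈ S ∧ limsup
    (fun w => ((inner ℝ v (w - x) / ‖w - x‖ : ℝ) : EReal)) (𝓝[S \ {x}] x) ≤ 0}

/-- Limiting (Mordukhovich) normal cone of a set at one of its points. -/
def limitingNormalCone (S : Set E) (x : E) : Set E :=
  {v | x ∈ S ∧ ∃ (w : ℕ → E) (g : ℕ → E),
    Tendsto w atTop (𝓝 x) ∧ (∀ k, w k ∈ S) ∧
    (∀ k, g k ∈ regularNormalCone S (w k)) ∧ Tendsto g atTop (𝓝 v)}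

/-- The transposed Jacobian `∇L(x)` of a mapping `L`. -/
def nablaMap {F : Type*} [NormedAddCommGroup F] [InnerProductSpace ℝ F]
    [CompleteSpace E] [CompleteSpace F] (L : E → F) (x : E) : F →L[ℝ] E :=
  ContinuousLinearMap.adjoint (fderiv ℝ L x)

end Variational

/-! ### Spaces and their blocks -/

/-- Coordinates of `(x; y_1; …; y_K)`. -/
abbrev PIdx (m₁ m₂ K : ℕ) := Fin m₁ ⊕ (Fin K × Fin m₂)

/-- The space of the primal variables of both stages. -/
abbrev PSpace (m₁ m₂ K : ℕ) := EuclideanSpace ℝ (PIdx m₁ m₂ K)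

/-- The space of the constraint values (and of the multipliers): first-stage equalities,
first-stage conic constraints, second-stage equalities, second-stage conic constraints. -/
abbrev CSpace (n₁ s₁ n₂ s₂ K : ℕ) :=
  EuclideanSpace ℝ (Fin n₁ ⊕ (Fin s₁ ⊕ ((Fin K × Fin n₂) ⊕ (Fin K × Fin s₂))))

/-- The space of the values of the inner affine mapping. -/
abbrev USpace {K : ℕ} (l₁ : ℕ) (l₂ : Fin K → ℕ) :=
  EuclideanSpace ℝ (Fin l₁ ⊕ (Σ i : Fin K, Fin (l₂ i)))

section Blocks

variable {m₁ m₂ n₁ s₁ n₂ s₂ K l₁ : ℕ} {l₂ : Fin K → ℕ}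

/-- First-stage variable `x`. -/
def stageOne (z : PSpace m₁ m₂ K) : EuclideanSpace ℝ (Fin m₁) :=
  WithLp.toLp 2 fun j => z (Sum.inl j)

/-- Second-stage variable `y_i`. -/
def stageTwo (z : PSpace m₁ m₂ K) (i : Fin K) : EuclideanSpace ℝ (Fin m₂) :=
  WithLp.toLp 2 fun j => z (Sum.inr (i, j))

def eqOne (v : CSpace n₁ s₁ n₂ s₂ K) : EuclideanSpace ℝ (Fin n₁) :=
  WithLp.toLp 2 fun j => v (Sum.inl j)

def coneOne (v : CSpace n₁ s₁ n₂ s₂ K) : EuclideanSpace ℝ (Fin s₁) :=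
  WithLp.toLp 2 fun j => v (Sum.inr (Sum.inl j))

def eqTwo (v : CSpace n₁ s₁ n₂ s₂ K) (i : Fin K) : EuclideanSpace ℝ (Fin n₂) :=
  WithLp.toLp 2 fun j => v (Sum.inr (Sum.inr (Sum.inl (i, j))))

def coneTwo (v : CSpace n₁ s₁ n₂ s₂ K) (i : Fin K) : EuclideanSpace ℝ (Fin s₂) :=
  WithLp.toLp 2 fun j => v (Sum.inr (Sum.inr (Sum.inr (i, j))))

def uOne (w : USpace l₁ l₂) : EuclideanSpace ℝ (Fin l₁) :=
  WithLp.toLp 2 fun j => w (Sum.inl j)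

def uTwo (w : USpace l₁ l₂) (i : Fin K) : EuclideanSpace ℝ (Fin (l₂ i)) :=
  WithLp.toLp 2 fun j => w (Sum.inr ⟨i, j⟩)

end Blocks

/-! ### The problem -/

/-- The data of a two-stage stochastic conic program with `K` scenarios. The letters with
index `ξ` depend on the scenario. A `ProperCone` is a closed convex cone containing `0`. -/
structure Problem (m₁ m₂ n₁ s₁ n₂ s₂ K l₁ : ℕ) (l₂ : Fin K → ℕ) where
  p : Fin K → ℝ
  A : Matrix (Fin n₁) (Fin m₁) ℝ
  a : EuclideanSpace ℝ (Fin n₁)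
  B : Matrix (Fin s₁) (Fin m₁) ℝ
  b : EuclideanSpace ℝ (Fin s₁)
  A₁ξ : Fin K → Matrix (Fin n₂) (Fin m₂) ℝ
  A₂ξ : Fin K → Matrix (Fin n₂) (Fin m₁) ℝ
  dξ : Fin K → EuclideanSpace ℝ (Fin n₂)
  Wξ : Fin K → Matrix (Fin s₂) (Fin m₂) ℝ
  Tξ : Fin K → Matrix (Fin s₂) (Fin m₁) ℝ
  hξ : Fin K → EuclideanSpace ℝ (Fin s₂)
  C₁ : ProperCone ℝ (EuclideanSpace ℝ (Fin s₁))
  C₂ξ : Fin K → ProperCone ℝ (EuclideanSpace ℝ (Fin s₂))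
  c : EuclideanSpace ℝ (Fin m₁) → ℝ
  qξ : Fin K → EuclideanSpace ℝ (Fin m₂) → ℝ
  U₁ : Matrix (Fin l₁) (Fin m₁) ℝ
  u₁ : EuclideanSpace ℝ (Fin l₁)
  Uξ : (i : Fin K) → Matrix (Fin (l₂ i)) (Fin m₂) ℝ
  uξ : (i : Fin K) → EuclideanSpace ℝ (Fin (l₂ i))
  P₁ : EuclideanSpace ℝ (Fin l₁) → ℝ
  Pξ : (i : Fin K) → EuclideanSpace ℝ (Fin (l₂ i)) → ℝ

namespace Problem

variable {m₁ m₂ n₁ s₁ n₂ s₂ K l₁ : ℕ} {l₂ : Fin K → ℕ}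
variable (D : Problem m₁ m₂ n₁ s₁ n₂ s₂ K l₁ l₂)

/-- The model assumptions on the data: probabilities, cones with nonempty interior,
lower semicontinuous outer functions that are bounded from below, twice continuously
differentiable convex smooth parts. -/
structure Standing : Prop where
  p_nonneg : ∀ i, 0 ≤ D.p i
  p_sum : ∑ i, D.p i = 1
  C₁_int : (interior (D.C₁ : Set (EuclideanSpace ℝ (Fin s₁)))).Nonempty
  C₂ξ_int : ∀ i, (interior (D.C₂ξ i : Set (EuclideanSpace ℝ (Fin s₂)))).Nonempty
  P₁_lsc : LowerSemicontinuous D.P₁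
  P₁_bdd : BddBelow (Set.range D.P₁)
  Pξ_lsc : ∀ i, LowerSemicontinuous (D.Pξ i)
  Pξ_bdd : ∀ i, BddBelow (Set.range (D.Pξ i))
  c_smooth : ContDiff ℝ 2 D.c
  c_convex : ConvexOn ℝ Set.univ D.c
  qξ_smooth : ∀ i, ContDiff ℝ 2 (D.qξ i)
  qξ_convex : ∀ i, ConvexOn ℝ Set.univ (D.qξ i)

/-- Smooth part of the objective. -/
def fHat (z : PSpace m₁ m₂ K) : ℝ :=
  D.c (stageOne z) + ∑ i, D.p i * D.qξ i (stageTwo z i)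

/-- Inner affine mapping `𝒰(x, y) = (U₁ x + u₁; U_ξ y + u_ξ)`. -/
def innerMap (z : PSpace m₁ m₂ K) : USpace l₁ l₂ :=
  WithLp.toLp 2 (Sum.elim
    (fun j => (D.U₁.toEuclideanLin (stageOne z) + D.u₁) j)
    (fun ij => ((D.Uξ ij.1).toEuclideanLin (stageTwo z ij.1) + D.uξ ij.1) ij.2))

/-- Outer function `P(w) = P₁(w₁) + ∑ p_i P_ξ(w_{2,i})`. -/
def outerFun (w : USpace l₁ l₂) : ℝ :=
  D.P₁ (uOne w) + ∑ i, D.p i * D.Pξ i (uTwo w i)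

/-- Nonsmooth part of the objective, `Ψ = P ∘ 𝒰`. -/
def Psi (z : PSpace m₁ m₂ K) : ℝ := D.outerFun (D.innerMap z)

/-- Constraint mapping `G`. -/
def G (z : PSpace m₁ m₂ K) : CSpace n₁ s₁ n₂ s₂ K :=
  WithLp.toLp 2 (Sum.elim
    (fun j => (D.A.toEuclideanLin (stageOne z) - D.a) j)
    (Sum.elim
      (fun j => (D.B.toEuclideanLin (stageOne z) - D.b) j)
      (Sum.elim
        (fun ij => ((D.A₁ξ ij.1).toEuclideanLin (stageTwo z ij.1)
          + (D.A₂ξ ij.1).toEuclideanLin (stageOne z) - D.dξ ij.1) ij.2)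
        (fun ij => ((D.Wξ ij.1).toEuclideanLin (stageTwo z ij.1)
          + (D.Tξ ij.1).toEuclideanLin (stageOne z) - D.hξ ij.1) ij.2))))

/-- The cone `𝒦 = {0} × (-C₁) × {0}^K × ∏ (-C_{2,ξ})`. -/
def cone : Set (CSpace n₁ s₁ n₂ s₂ K) :=
  {v | eqOne v = 0 ∧ -coneOne v ∈ D.C₁ ∧ (∀ i, eqTwo v i = 0) ∧ ∀ i, -coneTwo v i ∈ D.C₂ξ i}

/-- Feasible set `Φ`. -/
def feasible : Set (PSpace m₁ m₂ K) := {z | D.G z ∈ D.cone}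

/-- Local minimizer of `f̂ + Ψ` subject to `G ∈ 𝒦`. -/
def IsLocalMinimizer (z : PSpace m₁ m₂ K) : Prop :=
  z ∈ D.feasible ∧ IsLocalMinOn (fun w => D.fHat w + D.Psi w) D.feasible z

/-- The Robinson constraint qualification at `x` for a system `H(x) ∈ 𝒦`, where
`H` is a differentiable mapping on a Euclidean space: the gradients of all equality components are
linearly independent, and some direction `d` is a linearized Slater direction. -/
def RCQ {E : Type*} [NormedAddCommGroup E] [InnerProductSpace ℝ E] [CompleteSpace E]
    (H : E → CSpace n₁ s₁ n₂ s₂ K) (x : E) : Prop :=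
  H x ∈ D.cone ∧
  LinearIndependent ℝ
    (Sum.elim (fun j : Fin n₁ => gradient (fun w => eqOne (H w) j) x)
      (fun ij : Fin K × Fin n₂ => gradient (fun w => eqTwo (H w) ij.1 ij.2) x)) ∧
  ∃ d : E,
    fderiv ℝ (fun w => eqOne (H w)) x d = 0 ∧
    (∀ i, fderiv ℝ (fun w => eqTwo (H w) i) x d = 0) ∧
    coneOne (H x) + fderiv ℝ (fun w => coneOne (H w)) x d ∈
      interior (-(D.C₁ : Set (EuclideanSpace ℝ (Fin s₁)))) ∧
    ∀ i, coneTwo (H x) i + fderiv ℝ (fun w => coneTwo (H w) i) x d ∈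
      interior (-(D.C₂ξ i : Set (EuclideanSpace ℝ (Fin s₂))))

/-- KKT point. -/
def IsKKT (z : PSpace m₁ m₂ K) : Prop :=
  z ∈ D.feasible ∧ ∃ lam ∈ limitingSubdiff D.outerFun (D.innerMap z),
    ∃ M ∈ limitingNormalCone D.cone (D.G z),
      0 = gradient D.fHat z + nablaMap D.innerMap z lam + nablaMap D.G z M

/-- Stationarity with respect to `Ψ` itself:
`0 ∈ ∇f̂(z) + ∂Ψ(z) + ∇G(z) N_𝒦(G(z))` at a feasible point. -/
def IsStationary (z : PSpace m₁ m₂ K) : Prop :=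
  z ∈ D.feasible ∧ ∃ v ∈ limitingSubdiff D.Psi z,
    ∃ M ∈ limitingNormalCone D.cone (D.G z),
      0 = gradient D.fHat z + v + nablaMap D.G z M

end Problem

/-! ### Fixing some of the coordinates -/

section Coordinates

variable {ι : Type*} [Fintype ι]

open Classical in
/-- The subvector `z_I`. -/
def restrict (I : Set ι) (z : EuclideanSpace ℝ ι) : EuclideanSpace ℝ I :=
  WithLp.toLp 2 fun j => z j

open Classical in
/-- The vector `(w, z_{Iᶜ})` with the coordinates of `w` on `I` and those of `z` off `I`. -/
def merge (I : Set ι) (z : EuclideanSpace ℝ ι) (w : EuclideanSpace ℝ I) : EuclideanSpace ℝ ι :=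
  WithLp.toLp 2 fun j => if h : j ∈ I then w ⟨j, h⟩ else z j

open Classical in
/-- The RCQ at `z_I` for the system `G(w, z_{Iᶜ}) ∈ 𝒦` in the variable `w = (x_y)_I`. -/
def Problem.RestrictedRCQ {m₁ m₂ n₁ s₁ n₂ s₂ K l₁ : ℕ} {l₂ : Fin K → ℕ}
    (D : Problem m₁ m₂ n₁ s₁ n₂ s₂ K l₁ l₂) (I : Set (PIdx m₁ m₂ K))
    (z : PSpace m₁ m₂ K) : Prop :=
  D.RCQ (fun w : EuclideanSpace ℝ I => D.G (merge I z w)) (restrict I z)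

/-- `ℐ = {j : ∂^∞ ψ_j(z_j) = {0}}`. -/
def lipIndices (ψ : ι → ℝ → ℝ) (z : EuclideanSpace ℝ ι) : Set ι :=
  {j | horizonSubdiff (ψ j) (z j) = {0}}

end Coordinates

end TwoStage

end

/-! Write `I` for `lipIndices ψ z`. Freezing the coordinates off `I` at their values in `z` keeps
`z` a local minimizer, now over a closed convex set `C`. The price is an arbitrary multiplier on the
frozen coordinates, and it costs nothing: there the limiting subdifferential of `ψ j` is all of `ℝ`
and absorbs any number.

On `C` the term `∑ ψ j` is only lower semicontinuous, so it is decoupled from the constraints.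
Minimize `f w + ∑ ψ j (u j) + κ ‖w - u‖² + ‖w - z‖²` with `w ∈ C` and `u` constrained only in its
frozen coordinates. Minimality in `u` makes `2κ(w - u)` a Fréchet subgradient coordinatewise on `I`,
and minimality in `w` gives a variational inequality with the same vector. Trivial horizon
subdifferentials bound these vectors, so a subsequence converges to some `v`, and `-(∇f̂ + v)` is
normal to `C` at `z` (`exists_subgradient_of_isLocalMinOn`).

The constraints are affine and convex, and the RCQ supplies a Slater direction, so a separation
argument splits this normal into `∇G M` plus a vector `r` supported off `I` (`exists_multiplier`).
Then `v + r` is a limiting subgradient of the separable function `Ψ`, which is stationarity.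

For the KKT claim, full row rank makes `𝒰` surjective, and every limiting subgradient of `P ∘ 𝒰` is
then the adjoint image of one of `P` (`exists_mem_limitingSubdiff_of_comp`). -/

namespace TwoStage

/-! ### Calculus of Fréchet, limiting and horizon subgradients. -/

section Subdifferentials

variable {E F : Type*} [NormedAddCommGroup E] [InnerProductSpace ℝ E]
  [NormedAddCommGroup F] [InnerProductSpace ℝ F]

/-- Clears the quotient and the extended-real lower limit. Both sides vanish at `w = x`, so the
punctured neighbourhood can be replaced by a full one. -/
lemma mem_frechetSubdiff_iff {f : E → ℝ} {x v : E} :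
    v ∈ frechetSubdiff f x ↔
      ∀ ε > 0, ∀ᶠ w in 𝓝 x, -(ε * ‖w - x‖) ≤ f w - f x - inner ℝ v (w - x) := by
  rw [frechetSubdiff, Set.mem_ofPred_eq, Filter.le_liminf_iff]
  constructor
  · intro h ε hε
    have h1 := h ((-ε : ℝ) : EReal) (by exact_mod_cast neg_neg_of_pos hε)
    rw [eventually_nhdsWithin_iff] at h1
    filter_upwards [h1] with w hw
    by_cases hx : w = x
    · simp [hx]
    · have h2 : -ε < (f w - f x - inner ℝ v (w - x)) / ‖w - x‖ := by
        exact_mod_cast hw hx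
      have h3 : 0 < ‖w - x‖ := norm_pos_iff.2 (sub_ne_zero.2 hx)
      rw [lt_div_iff₀ h3] at h2
      linarith
  · intro h y hy
    obtain ⟨t, hyt, ht⟩ := EReal.lt_iff_exists_real_btwn.1 hy
    have ht0 : t < 0 := by exact_mod_cast ht
    rw [eventually_nhdsWithin_iff]
    filter_upwards [h (-t) (by linarith)] with w hw hx
    have h3 : 0 < ‖w - x‖ := norm_pos_iff.2 (sub_ne_zero.2 hx)
    refine hyt.trans_le ?_
    rw [EReal.coe_le_coe_iff, le_div_iff₀ h3]
    linarith

/-- The global inequality already makes `v` a regular normal at `x`, so constant sequences suffice.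
-/
lemma mem_limitingNormalCone_of_inner_nonpos {S : Set E} {x v : E} (hx : x ∈ S)
    (h : ∀ w ∈ S, inner ℝ v (w - x) ≤ 0) : v ∈ limitingNormalCone S x := by
  refine ⟨hx, fun _ => x, fun _ => v, tendsto_const_nhds, fun _ => hx, fun _ => ⟨hx, ?_⟩,
    tendsto_const_nhds⟩
  refine Filter.limsup_le_of_le (h := ?_)
  filter_upwards [self_mem_nhdsWithin] with w hw
  exact_mod_cast div_nonpos_of_nonpos_of_nonneg (h w hw.1) (norm_nonneg _)

/-- Fréchet subgradients along an attentively converging sequence stay bounded when the horizon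
subdifferential is trivial. -/
lemma eventually_norm_le_of_horizonSubdiff_subset [FiniteDimensional ℝ E] {f : E → ℝ} {x : E}
    (h : horizonSubdiff f x ⊆ {0}) {w g : ℕ → E} (hw : Tendsto w atTop (𝓝 x))
    (hf : Tendsto (fun k => f (w k)) atTop (𝓝 (f x))) (hg : ∀ k, g k ∈ frechetSubdiff f (w k)) :
    ∃ R : ℝ, ∀ᶠ k in atTop, ‖g k‖ ≤ R := by
  by_contra! hcon
  have hfreq : ∀ n : ℕ, ∃ᶠ k in atTop, ((n : ℝ) + 1) < ‖g k‖ := fun n =>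
    (hcon ((n : ℝ) + 1)).mono fun k hk => hk
  obtain ⟨φ, hφ, hlt⟩ := Filter.extraction_forall_of_frequently hfreq
  have hpos : ∀ n, 0 < ‖g (φ n)‖ := fun n => lt_trans (by positivity) (hlt n)
  have hinf : Tendsto (fun n => ‖g (φ n)‖) atTop atTop :=
    tendsto_atTop_mono (fun n => by linarith [hlt n]) tendsto_natCast_atTop_atTop
  have hsph : ∀ n, (‖g (φ n)‖⁻¹ • g (φ n)) ∈ Metric.sphere (0 : E) 1 := fun n => by
    rw [mem_sphere_zero_iff_norm, norm_smul, norm_inv, norm_norm, inv_mul_cancel₀ (hpos n).ne']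
  have : ProperSpace E := FiniteDimensional.proper ℝ E
  obtain ⟨v, hv, θ, hθ, hlim⟩ := (isCompact_sphere (0 : E) 1).tendsto_subseq hsph
  -- If the norms were unbounded, the scalings `‖g‖⁻¹ → 0` along a subsequence would produce a unit
  -- horizon subgradient.
  have hmem : v ∈ horizonSubdiff f x :=
    ⟨fun n => w (φ (θ n)), fun n => g (φ (θ n)), fun n => ‖g (φ (θ n))‖⁻¹,
      hw.comp (hφ.tendsto_atTop.comp hθ.tendsto_atTop),
      hf.comp (hφ.tendsto_atTop.comp hθ.tendsto_atTop),
      fun n => inv_pos.2 (hpos _),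
      (tendsto_inv_atTop_zero.comp hinf).comp hθ.tendsto_atTop, fun n => hg _, hlim⟩
  have h0 : v = 0 := h hmem
  rw [h0] at hv
  simp at hv

lemma toLp_mem_frechetSubdiff_sum {ι : Type*} [Fintype ι] {ψ : ι → ℝ → ℝ}
    {w : EuclideanSpace ℝ ι} {g : ι → ℝ} (h : ∀ j, g j ∈ frechetSubdiff (ψ j) (w j)) :
    (WithLp.toLp 2 g : EuclideanSpace ℝ ι) ∈
      frechetSubdiff (fun x : EuclideanSpace ℝ ι => ∑ j, ψ j (x j)) w := by
  rw [mem_frechetSubdiff_iff]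
  intro ε hε
  -- The tolerance `ε` is shared among the coordinates; the `+ 1` covers an empty index type.
  have hδ : 0 < ε / (Fintype.card ι + 1) := by positivity
  have hev : ∀ j, ∀ᶠ x : EuclideanSpace ℝ ι in 𝓝 w,
      -(ε / (Fintype.card ι + 1) * ‖x j - w j‖) ≤
        ψ j (x j) - ψ j (w j) - inner ℝ (g j) (x j - w j) := fun j =>
    ((PiLp.continuous_apply 2 _ j).tendsto w).eventually (mem_frechetSubdiff_iff.1 (h j) _ hδ)
  filter_upwards [eventually_all.2 hev] with x hx
  have hsum := Finset.sum_le_sum fun j (_ : j ∈ Finset.univ) => hx j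
  have hin : inner ℝ (WithLp.toLp 2 g : EuclideanSpace ℝ ι) (x - w) =
      ∑ j, inner ℝ (g j) (x j - w j) := by
    rw [PiLp.inner_apply]; rfl
  rw [hin, ← Finset.sum_sub_distrib, ← Finset.sum_sub_distrib]
  refine le_trans ?_ hsum
  rw [Finset.sum_neg_distrib, neg_le_neg_iff]
  calc ∑ j, ε / (Fintype.card ι + 1) * ‖x j - w j‖
      ≤ ∑ _j : ι, ε / (Fintype.card ι + 1) * ‖x - w‖ := by
        gcongr with j
        exact PiLp.norm_apply_le (x - w) j
    _ = (Fintype.card ι * (ε / (Fintype.card ι + 1))) * ‖x - w‖ := by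
        rw [Finset.sum_const, Finset.card_univ, nsmul_eq_mul]; ring
    _ ≤ ε * ‖x - w‖ := by
        gcongr
        rw [mul_div_assoc', div_le_iff₀ (by positivity)]
        nlinarith

/-- The summands depend on different coordinates, so their approximating sequences can be chosen
independently and stacked into one vector sequence. -/
lemma mem_limitingSubdiff_sum {ι : Type*} [Fintype ι] {ψ : ι → ℝ → ℝ}
    {z v : EuclideanSpace ℝ ι} (h : ∀ j, v j ∈ limitingSubdiff (ψ j) (z j)) :
    v ∈ limitingSubdiff (fun x : EuclideanSpace ℝ ι => ∑ j, ψ j (x j)) z := by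
  choose w g hw hf hg hv using h
  refine ⟨fun k => WithLp.toLp 2 fun j => w j k, fun k => WithLp.toLp 2 fun j => g j k,
    ?_, ?_, ?_, ?_⟩
  · exact ((PiLp.continuous_toLp 2 _).tendsto _).comp (tendsto_pi_nhds.2 hw)
  · exact tendsto_finsetSum _ fun j _ => hf j
  · exact fun k => toLp_mem_frechetSubdiff_sum fun j => hg j k
  · exact ((PiLp.continuous_toLp 2 _).tendsto _).comp (tendsto_pi_nhds.2 hv)

/-- The function is constant along directions in `ker L`, so a subgradient cannot have a positive
slope along `h` or along `-h`. -/
lemma inner_eq_zero_of_mem_frechetSubdiff_comp {f : F → ℝ} {L : E →L[ℝ] F} {b : F} {x g : E}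
    (hg : g ∈ frechetSubdiff (fun x => f (L x + b)) x) {h : E} (hh : L h = 0) :
    inner ℝ g h = 0 := by
  have key : ∀ h : E, L h = 0 → inner ℝ g h ≤ 0 := by
    intro h hh
    by_contra! hpos
    have hn : 0 < ‖h‖ := norm_pos_iff.2 (by rintro rfl; simp at hpos)
    have h1 := mem_frechetSubdiff_iff.1 hg (inner ℝ g h / (2 * ‖h‖)) (by positivity)
    have hc : Tendsto (fun t : ℝ => x + t • h) (𝓝[>] 0) (𝓝 x) := by
      have : Tendsto (fun t : ℝ => x + t • h) (𝓝 0) (𝓝 (x + (0 : ℝ) • h)) :=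
        (by fun_prop : Continuous fun t : ℝ => x + t • h).tendsto 0
      rw [zero_smul, add_zero] at this
      exact this.mono_left nhdsWithin_le_nhds
    obtain ⟨t, ht, ht0⟩ := ((hc.eventually h1).and self_mem_nhdsWithin).exists
    have ht0 : 0 < t := ht0
    simp only [map_add, map_smul, hh, smul_zero, add_zero, sub_self, add_sub_cancel_left,
      inner_smul_right, norm_smul, Real.norm_eq_abs, abs_of_pos ht0, zero_sub] at ht
    have : inner ℝ g h / (2 * ‖h‖) * (t * ‖h‖) = t * inner ℝ g h / 2 := by field_simp
    rw [this] at ht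
    nlinarith [mul_pos ht0 hpos]
  refine le_antisymm (key h hh) ?_
  have := key (-h) (by rw [map_neg, hh, neg_zero])
  rw [inner_neg_right] at this
  linarith

variable [FiniteDimensional ℝ F] [CompleteSpace E] [CompleteSpace F]

/-- Subgradients of a composition with a surjective affine map. -/
lemma exists_mem_limitingSubdiff_of_comp {f : F → ℝ} {L : E →L[ℝ] F}
    (hL : Function.Surjective L) {b : F} {x v : E}
    (hv : v ∈ limitingSubdiff (fun x => f (L x + b)) x) :
    ∃ lam ∈ limitingSubdiff f (L x + b), ContinuousLinearMap.adjoint L lam = v := by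
  obtain ⟨R', hR'⟩ := LinearMap.exists_rightInverse_of_surjective (L : E →ₗ[ℝ] F)
    (LinearMap.range_eq_top.2 hL)
  set R : F →L[ℝ] E := LinearMap.toContinuousLinearMap R' with hRdef
  have hR : ∀ y, L (R y) = y := fun y => LinearMap.congr_fun hR' y
  obtain ⟨w, g, hw, hf, hg, hlim⟩ := hv
  -- `R (L h) - h` lies in `ker L`, where `g k` vanishes; hence `adjoint R (g k)` is a preimage of
  -- `g k` under `adjoint L`.
  have hadj : ∀ k, ContinuousLinearMap.adjoint L (ContinuousLinearMap.adjoint R (g k)) = g k := by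
    intro k
    refine ext_inner_right ℝ fun h => ?_
    rw [ContinuousLinearMap.adjoint_inner_left, ContinuousLinearMap.adjoint_inner_left]
    have := inner_eq_zero_of_mem_frechetSubdiff_comp (hg k) (h := R (L h) - h)
      (by rw [map_sub, hR, sub_self])
    rw [inner_sub_right] at this
    linarith
  have hlimR : Tendsto (fun k => ContinuousLinearMap.adjoint R (g k)) atTop
      (𝓝 (ContinuousLinearMap.adjoint R v)) :=
    ((ContinuousLinearMap.adjoint R).continuous.tendsto v).comp hlim
  refine ⟨ContinuousLinearMap.adjoint R v, ⟨fun k => L (w k) + b,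
    fun k => ContinuousLinearMap.adjoint R (g k), ?_, hf, fun k => ?_, hlimR⟩, ?_⟩
  · exact ((L.continuous.tendsto x).comp hw).add_const b
  · rw [mem_frechetSubdiff_iff]
    intro ε hε
    have h1 := mem_frechetSubdiff_iff.1 (hg k) (ε / (‖R‖ + 1)) (by positivity)
    -- This map is an affine section of `x ↦ L x + b` through `w k`; the subgradient inequality for
    -- `f` is that of the composition read along it.
    have hc : Tendsto (fun u => w k + R (u - (L (w k) + b))) (𝓝 (L (w k) + b)) (𝓝 (w k)) := by
      have := (by fun_prop : Continuous fun u => w k + R (u - (L (w k) + b))).tendsto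
        (L (w k) + b)
      simpa using this
    filter_upwards [hc.eventually h1] with u hu
    have e1 : L (w k + R (u - (L (w k) + b))) + b = u := by
      rw [map_add, hR]; abel
    rw [e1, add_sub_cancel_left] at hu
    rw [ContinuousLinearMap.adjoint_inner_left]
    refine le_trans ?_ hu
    rw [neg_le_neg_iff]
    calc ε / (‖R‖ + 1) * ‖R (u - (L (w k) + b))‖
        ≤ ε / (‖R‖ + 1) * ((‖R‖ + 1) * ‖u - (L (w k) + b)‖) := by
          gcongr
          exact (R.le_opNorm _).trans (by gcongr; linarith)
      _ = ε * ‖u - (L (w k) + b)‖ := by field_simp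
  · refine tendsto_nhds_unique
      (((ContinuousLinearMap.adjoint L).continuous.tendsto _).comp hlimR) ?_
    simpa only [Function.comp_def, hadj] using hlim

end Subdifferentials

/-! ### Quadratic penalization and convergence of the penalized minimizers. -/

section Penalization

/-- Decoupling: minimizers of the quadratically penalized problem
`f w + Φ u + n ‖w - u‖² + ‖w - z‖²` over `(C × S)` near `z`. -/
lemma exists_penalized_minimizers {E : Type*} [NormedAddCommGroup E] [ProperSpace E]
    {f Φ : E → ℝ} (hf : Continuous f) (hΦ : LowerSemicontinuous Φ) {C S : Set E}
    (hC : IsClosed C) (hS : IsClosed S) (hCS : C ⊆ S) {z : E} (hz : z ∈ C)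
    (hmin : IsLocalMinOn (fun w => f w + Φ w) C z) :
    ∃ r > 0, ∃ (w u : ℕ → E) (κ : ℕ → ℝ),
      (∀ k, w k ∈ C) ∧ (∀ k, u k ∈ S) ∧
      (∀ k, w k ∈ Metric.ball z r) ∧ (∀ k, u k ∈ Metric.ball z r) ∧
      Tendsto w atTop (𝓝 z) ∧ Tendsto u atTop (𝓝 z) ∧
      Tendsto (fun k => Φ (u k)) atTop (𝓝 (Φ z)) ∧
      ∀ k, ∀ w' ∈ C, w' ∈ Metric.ball z r → ∀ u' ∈ S, u' ∈ Metric.ball z r →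
        f (w k) + Φ (u k) + κ k * ‖w k - u k‖ ^ 2 + ‖w k - z‖ ^ 2 ≤
          f w' + Φ u' + κ k * ‖w' - u'‖ ^ 2 + ‖w' - z‖ ^ 2 := by
  obtain ⟨r, hr, hball⟩ : ∃ r > 0, ∀ w ∈ Metric.closedBall z r, w ∈ C →
      f z + Φ z ≤ f w + Φ w := by
    have h1 : ∀ᶠ w in 𝓝 z, w ∈ C → f z + Φ z ≤ f w + Φ w := eventually_nhdsWithin_iff.1 hmin
    obtain ⟨r, hr, h⟩ := Metric.nhds_basis_closedBall.eventually_iff.1 h1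
    exact ⟨r, hr, fun w hw => h hw⟩
  set Q : Set (E × E) := (C ∩ Metric.closedBall z r) ×ˢ (S ∩ Metric.closedBall z r) with hQ
  have hQc : IsCompact Q := ((isCompact_closedBall z r).inter_left hC).prod
    ((isCompact_closedBall z r).inter_left hS)
  have hzQ : (z, z) ∈ Q := ⟨⟨hz, Metric.mem_closedBall_self hr.le⟩,
    ⟨hCS hz, Metric.mem_closedBall_self hr.le⟩⟩
  set F : ℝ → E × E → ℝ := fun κ q =>
    f q.1 + Φ q.2 + κ * ‖q.1 - q.2‖ ^ 2 + ‖q.1 - z‖ ^ 2 with hF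
  have hFl : ∀ κ, LowerSemicontinuous (F κ) := fun κ => by
    have h1 : LowerSemicontinuous fun q : E × E => f q.1 :=
      (hf.comp continuous_fst).lowerSemicontinuous
    have h2 : LowerSemicontinuous fun q : E × E => Φ q.2 := hΦ.comp continuous_snd
    have h3 : LowerSemicontinuous fun q : E × E => κ * ‖q.1 - q.2‖ ^ 2 :=
      (by fun_prop : Continuous fun q : E × E => κ * ‖q.1 - q.2‖ ^ 2).lowerSemicontinuous
    have h4 : LowerSemicontinuous fun q : E × E => ‖q.1 - z‖ ^ 2 :=
      (by fun_prop : Continuous fun q : E × E => ‖q.1 - z‖ ^ 2).lowerSemicontinuous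
    exact ((h1.add h2).add h3).add h4
  have hex : ∀ n : ℕ, ∃ q ∈ Q, IsMinOn (F n) Q q := fun n =>
    ((hFl n).lowerSemicontinuousOn Q).exists_isMinOn ⟨_, hzQ⟩ hQc
  choose q hqQ hqmin using hex
  have hub : ∀ n : ℕ, F n (q n) ≤ f z + Φ z := fun n => by
    have := isMinOn_iff.1 (hqmin n) _ hzQ
    simpa [hF] using this
  obtain ⟨⟨w₀, u₀⟩, hlQ, φ, hφ, hlim⟩ := hQc.tendsto_subseq hqQ
  have hw : Tendsto (fun n => (q (φ n)).1) atTop (𝓝 w₀) :=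
    (continuous_fst.tendsto _).comp hlim
  have hu : Tendsto (fun n => (q (φ n)).2) atTop (𝓝 u₀) :=
    (continuous_snd.tendsto _).comp hlim
  -- The minimum of `F 0` over `Q` bounds the unpenalized part from below, so the penalty stays
  -- bounded and `‖w - u‖` must tend to zero.
  have hpen : ∀ n : ℕ, (n : ℝ) * ‖(q n).1 - (q n).2‖ ^ 2 ≤ f z + Φ z - F 0 (q 0) := fun n => by
    have h1 := hub n
    have h2 := isMinOn_iff.1 (hqmin 0) _ (hqQ n)
    simp only [hF, Nat.cast_zero, zero_mul, add_zero] at h1 h2 ⊢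
    linarith
  have heq : w₀ = u₀ := by
    have h1 : Tendsto (fun n => ‖(q (φ n)).1 - (q (φ n)).2‖ ^ 2) atTop (𝓝 (‖w₀ - u₀‖ ^ 2)) :=
      ((hw.sub hu).norm).pow 2
    have h2 : Tendsto (fun n => (f z + Φ z - F 0 (q 0)) / (φ n : ℝ)) atTop (𝓝 0) :=
      (tendsto_const_div_atTop_nhds_zero_nat (f z + Φ z - F 0 (q 0))).comp hφ.tendsto_atTop
    have h3 : ‖w₀ - u₀‖ ^ 2 ≤ 0 := by
      refine le_of_tendsto_of_tendsto h1 h2 ?_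
      filter_upwards [eventually_gt_atTop 0] with n hn
      have : (0 : ℝ) < φ n := by exact_mod_cast hn.trans_le (hφ.id_le n)
      rw [le_div_iff₀ this, mul_comm]
      exact hpen _
    have h4 : ‖w₀ - u₀‖ = 0 := by
      have := sq_nonneg ‖w₀ - u₀‖
      exact pow_eq_zero_iff two_ne_zero |>.1 (le_antisymm h3 this)
    exact sub_eq_zero.1 (norm_eq_zero.1 h4)
  subst heq
  have hlow : F 0 (w₀, w₀) ≤ f z + Φ z := by
    refine le_of_forall_lt fun y hy => ?_
    obtain ⟨n, hn⟩ := (hlim.eventually (hFl 0 _ y hy)).exists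
    refine hn.trans_le (le_trans ?_ (hub (φ n)))
    simp only [hF, Function.comp]
    have : (0 : ℝ) ≤ (φ n : ℝ) * ‖(q (φ n)).1 - (q (φ n)).2‖ ^ 2 := by positivity
    linarith
  -- Local minimality gives `f z + Φ z ≤ f w₀ + Φ w₀`, so the proximal term `‖w₀ - z‖²` in `hlow`
  -- has to vanish.
  have hwz : w₀ = z := by
    have h1 := hball w₀ hlQ.1.2 hlQ.1.1
    simp only [hF, zero_mul, add_zero] at hlow
    have h3 : ‖w₀ - z‖ ^ 2 ≤ 0 := by linarith
    have h4 := pow_eq_zero_iff two_ne_zero |>.1 (le_antisymm h3 (sq_nonneg _))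
    exact sub_eq_zero.1 (norm_eq_zero.1 h4)
  subst hwz
  -- The lower estimate is semicontinuity; the upper one comes from `hub` and continuity of `f`.
  have hΦlim : Tendsto (fun n => Φ (q (φ n)).2) atTop (𝓝 (Φ w₀)) := by
    rw [tendsto_order]
    refine ⟨fun y hy => hu.eventually (hΦ w₀ y hy), fun y hy => ?_⟩
    have h1 : Tendsto (fun n => f w₀ + Φ w₀ - f (q (φ n)).1) atTop (𝓝 (Φ w₀)) := by
      have := (((hf.tendsto w₀).comp hw).const_sub (f w₀ + Φ w₀))
      simpa using this
    filter_upwards [(tendsto_order.1 h1).2 y hy] with n hn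
    refine lt_of_le_of_lt ?_ hn
    have h2 := hub (φ n)
    simp only [hF] at h2
    have h3 : (0 : ℝ) ≤ (φ n : ℝ) * ‖(q (φ n)).1 - (q (φ n)).2‖ ^ 2 := by positivity
    have h4 := sq_nonneg ‖(q (φ n)).1 - w₀‖
    linarith
  -- Dropping finitely many terms puts all iterates in the open ball, so the localization imposes no
  -- active constraint.
  obtain ⟨N, hN⟩ := eventually_atTop.1
    ((hw.eventually (Metric.ball_mem_nhds _ hr)).and (hu.eventually (Metric.ball_mem_nhds _ hr)))
  have hshift := tendsto_add_atTop_nat N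
  refine ⟨r, hr, fun k => (q (φ (k + N))).1, fun k => (q (φ (k + N))).2, fun k => (φ (k + N) : ℝ),
    fun k => (hqQ _).1.1, fun k => (hqQ _).2.1, fun k => (hN _ (Nat.le_add_left _ _)).1,
    fun k => (hN _ (Nat.le_add_left _ _)).2, hw.comp hshift, hu.comp hshift,
    hΦlim.comp hshift, fun k w' hw'C hw' u' hu'S hu' => ?_⟩
  exact isMinOn_iff.1 (hqmin (φ (k + N))) (w', u')
    ⟨⟨hw'C, Metric.ball_subset_closedBall hw'⟩, ⟨hu'S, Metric.ball_subset_closedBall hu'⟩⟩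

/-- If all terms are lower semicontinuous and the sum converges, each term converges. -/
lemma tendsto_of_tendsto_sum {ι : Type*} [Fintype ι] {ψ : ι → ℝ → ℝ}
    (hψ : ∀ j, LowerSemicontinuous (ψ j)) {x : ℕ → ι → ℝ} {z : ι → ℝ}
    (hx : Tendsto x atTop (𝓝 z))
    (hsum : Tendsto (fun k => ∑ j, ψ j (x k j)) atTop (𝓝 (∑ j, ψ j (z j)))) (i : ι) :
    Tendsto (fun k => ψ i (x k i)) atTop (𝓝 (ψ i (z i))) := by
  classical
  rw [tendsto_order]
  have hlow : ∀ j, ∀ y < ψ j (z j), ∀ᶠ k in atTop, y < ψ j (x k j) := fun j y hy =>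
    (tendsto_pi_nhds.1 hx j).eventually (hψ j _ y hy)
  refine ⟨hlow i, fun y hy => ?_⟩
  -- One `δ` pays for the excess of the whole sum, and one for the possible drop of each other term.
  set δ := (y - ψ i (z i)) / (Fintype.card ι + 1) with hδ
  have hδ0 : 0 < δ := div_pos (by linarith) (by positivity)
  have hδy : ψ i (z i) + (Fintype.card ι) * δ + δ = y := by
    rw [hδ]; field_simp; ring
  filter_upwards [eventually_all.2 fun j => hlow j _ (sub_lt_self (ψ j (z j)) hδ0),
    (tendsto_order.1 hsum).2 _ (lt_add_of_pos_right _ hδ0)] with k hk hk2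
  have h1 : ∑ j ∈ Finset.univ.erase i, (ψ j (z j) - δ) ≤
      ∑ j ∈ Finset.univ.erase i, ψ j (x k j) := Finset.sum_le_sum fun j _ => (hk j).le
  rw [Finset.sum_sub_distrib, Finset.sum_const, nsmul_eq_mul] at h1
  have h2 := Finset.add_sum_erase Finset.univ (fun j => ψ j (z j)) (Finset.mem_univ i)
  have h3 := Finset.add_sum_erase Finset.univ (fun j => ψ j (x k j)) (Finset.mem_univ i)
  have h4 : ((Finset.univ.erase i).card : ℝ) * δ ≤ Fintype.card ι * δ := by
    gcongr
    exact Finset.card_le_univ _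
  linarith

end Penalization

/-! ### First-order conditions for the penalized problem and their limit. -/

section Optimality

variable {ι : Type*} [Fintype ι]

/-- First-order condition in the smooth variable of the penalized problem. -/
lemma inner_nonneg_of_penalized_min {E : Type*} [NormedAddCommGroup E] [InnerProductSpace ℝ E]
    [CompleteSpace E] {f : E → ℝ} {C : Set E} (hC : Convex ℝ C) {z w u : E} {κ r : ℝ}
    (hf : DifferentiableAt ℝ f w) (hw : w ∈ C) (hwr : w ∈ Metric.ball z r)
    (hmin : ∀ w' ∈ C, w' ∈ Metric.ball z r →
      f w + κ * ‖w - u‖ ^ 2 + ‖w - z‖ ^ 2 ≤ f w' + κ * ‖w' - u‖ ^ 2 + ‖w' - z‖ ^ 2)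
    {w' : E} (hw' : w' ∈ C) :
    0 ≤ inner ℝ (gradient f w + (2 * κ) • (w - u) + (2 : ℝ) • (w - z)) (w' - w) := by
  have hloc : IsLocalMinOn (fun x => f x + κ * ‖x - u‖ ^ 2 + ‖x - z‖ ^ 2) C w := by
    refine eventually_nhdsWithin_iff.2 ?_
    filter_upwards [Metric.isOpen_ball.mem_nhds hwr] with x hx hxC
    exact hmin x hxC hx
  have hsq : ∀ a : E, HasFDerivAt (fun x => ‖x - a‖ ^ 2)
      ((2 : ℝ) • (innerSL ℝ (w - a))) w := fun a => by
    have h1 := (((hasFDerivAt_id (𝕜 := ℝ) w).sub_const a).norm_sq)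
    refine h1.congr_fderiv ?_
    ext x
    simp [two_smul]
  have hd := ((hf.hasGradientAt.hasFDerivAt.add ((hsq u).const_mul κ)).add
    (hsq z)).hasFDerivWithinAt (s := C)
  have hseg : segment ℝ w (w + (w' - w)) ⊆ C := by
    rw [add_sub_cancel]
    exact hC.segment_subset hw hw'
  have := hloc.hasFDerivWithinAt_nonneg hd (mem_posTangentConeAt_of_segment_subset hseg)
  simpa [inner_add_left, inner_sub_left, real_inner_smul_left, mul_assoc, mul_left_comm] using this

/-- First-order condition in one separable variable of the penalized problem. -/
lemma mem_frechetSubdiff_of_penalized_min {ψ : ι → ℝ → ℝ} {I : Set ι}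
    {z w u : EuclideanSpace ℝ ι} {κ r : ℝ} (hu : ∀ j ∉ I, u j = z j)
    (hur : u ∈ Metric.ball z r)
    (hmin : ∀ u' : EuclideanSpace ℝ ι, (∀ j ∉ I, u' j = z j) → u' ∈ Metric.ball z r →
      ∑ j, ψ j (u j) + κ * ‖w - u‖ ^ 2 ≤ ∑ j, ψ j (u' j) + κ * ‖w - u'‖ ^ 2)
    {i : ι} (hi : i ∈ I) :
    2 * κ * (w i - u i) ∈ frechetSubdiff (ψ i) (u i) := by
  classical
  rw [mem_frechetSubdiff_iff]
  intro ε hε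
  have hcont : Continuous fun t : ℝ =>
      (WithLp.toLp 2 (Function.update u i t) : EuclideanSpace ℝ ι) :=
    (PiLp.continuous_toLp 2 _).comp (continuous_const.update i continuous_id)
  have hev : ∀ᶠ t in 𝓝 (u i),
      (WithLp.toLp 2 (Function.update u i t) : EuclideanSpace ℝ ι) ∈ Metric.ball z r := by
    refine hcont.continuousAt.eventually_mem (Metric.isOpen_ball.mem_nhds ?_)
    simpa using hur
  have hsmall : ∀ᶠ t in 𝓝 (u i), |κ| * |t - u i| ≤ ε := by
    have : Tendsto (fun t => |κ| * |t - u i|) (𝓝 (u i)) (𝓝 0) := by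
      have := (by fun_prop : Continuous fun t => |κ| * |t - u i|).tendsto (u i)
      simpa using this
    exact (tendsto_order.1 this).2 ε hε |>.mono fun _ h => h.le
  filter_upwards [hev, hsmall] with t ht hts
  have h := hmin (WithLp.toLp 2 (Function.update u i t)) (fun j hj => by
    have : j ≠ i := fun e => hj (e ▸ hi)
    simpa [Function.update_of_ne this] using hu j hj) ht
  rw [EuclideanSpace.norm_sq_eq, EuclideanSpace.norm_sq_eq,
    ← Finset.add_sum_erase _ _ (Finset.mem_univ i),
    ← Finset.add_sum_erase _ (fun j => ‖(w - u) j‖ ^ 2) (Finset.mem_univ i),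
    ← Finset.add_sum_erase _ (fun j => ψ j ((WithLp.toLp 2 (Function.update u i t) :
      EuclideanSpace ℝ ι) j)) (Finset.mem_univ i),
    ← Finset.add_sum_erase _ (fun j => ‖(w - (WithLp.toLp 2 (Function.update u i t) :
      EuclideanSpace ℝ ι)) j‖ ^ 2) (Finset.mem_univ i)] at h
  have e1 : ∑ j ∈ Finset.univ.erase i, ψ j ((WithLp.toLp 2 (Function.update u i t) :
      EuclideanSpace ℝ ι) j) = ∑ j ∈ Finset.univ.erase i, ψ j (u j) :=
    Finset.sum_congr rfl fun j hj => by simp [Function.update_of_ne (Finset.ne_of_mem_erase hj)]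
  have e2 : ∑ j ∈ Finset.univ.erase i, ‖(w - (WithLp.toLp 2 (Function.update u i t) :
      EuclideanSpace ℝ ι)) j‖ ^ 2 = ∑ j ∈ Finset.univ.erase i, ‖(w - u) j‖ ^ 2 :=
    Finset.sum_congr rfl fun j hj => by simp [Function.update_of_ne (Finset.ne_of_mem_erase hj)]
  rw [e1, e2] at h
  simp only [PiLp.sub_apply, Function.update_self, Real.norm_eq_abs, sq_abs] at h
  have hin : inner ℝ (2 * κ * (w i - u i)) (t - u i) = (t - u i) * (2 * κ * (w i - u i)) := rfl
  rw [hin, Real.norm_eq_abs]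
  -- Expanding the penalty at `u i` leaves the linear term of the claimed subgradient and this
  -- quadratic remainder.
  have h3 : κ * (t - u i) ^ 2 ≤ ε * |t - u i| := by
    calc κ * (t - u i) ^ 2 ≤ |κ| * (t - u i) ^ 2 := by gcongr; exact le_abs_self κ
      _ = |κ| * |t - u i| * |t - u i| := by rw [mul_assoc, ← sq, sq_abs]
      _ ≤ ε * |t - u i| := by gcongr
  nlinarith [h, h3]

/-- First-order condition at a constrained local minimizer: the coordinates in `I` have a trivial
horizon subdifferential, the other ones are fixed on the constraint set. -/
lemma exists_subgradient_of_isLocalMinOn {ψ : ι → ℝ → ℝ} (hψ : ∀ j, LowerSemicontinuous (ψ j))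
    {f : EuclideanSpace ℝ ι → ℝ} (hf : ContDiff ℝ 1 f) {I : Set ι}
    {C : Set (EuclideanSpace ℝ ι)} (hC : IsClosed C) (hCc : Convex ℝ C)
    {z : EuclideanSpace ℝ ι} (hz : z ∈ C) (hCI : ∀ w ∈ C, ∀ j ∉ I, w j = z j)
    (hI : ∀ j ∈ I, horizonSubdiff (ψ j) (z j) ⊆ {0})
    (hmin : IsLocalMinOn (fun w => f w + ∑ j, ψ j (w j)) C z) :
    ∃ v : EuclideanSpace ℝ ι, (∀ j ∈ I, v j ∈ limitingSubdiff (ψ j) (z j)) ∧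
      ∀ w ∈ C, 0 ≤ inner ℝ (gradient f z + v) (w - z) := by
  set Φ : EuclideanSpace ℝ ι → ℝ := fun w => ∑ j, ψ j (w j) with hΦ
  have hΦl : LowerSemicontinuous Φ := lowerSemicontinuous_sum fun j _ =>
    (hψ j).comp (PiLp.continuous_apply 2 _ j)
  -- `S` ignores the coupling in `C`, so each coordinate in `I` of `u` can be varied alone.
  set S : Set (EuclideanSpace ℝ ι) := {u | ∀ j ∉ I, u j = z j} with hS
  have hSc : IsClosed S := by
    have : S = ⋂ j ∈ Iᶜ, {u | u j = z j} := by ext; simp [hS]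
    rw [this]
    exact isClosed_biInter fun j _ =>
      isClosed_eq (PiLp.continuous_apply 2 _ j) continuous_const
  obtain ⟨r, hr, w, u, κ, hwC, huS, hwr, hur, hw, hu, hΦu, hopt⟩ :=
    exists_penalized_minimizers hf.continuous hΦl hC hSc hCI hz hmin
  have hψlim : ∀ j, Tendsto (fun k => ψ j (u k j)) atTop (𝓝 (ψ j (z j))) :=
    tendsto_of_tendsto_sum hψ (((PiLp.continuous_ofLp 2 _).tendsto z).comp hu) hΦu
  have hulim : ∀ j, Tendsto (fun k => u k j) atTop (𝓝 (z j)) := fun j =>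
    ((PiLp.continuous_apply 2 _ j).tendsto z).comp hu
  set g : ℕ → EuclideanSpace ℝ ι := fun k => (2 * κ k) • (w k - u k) with hg
  have hgI : ∀ j ∈ I, ∀ k, g k j ∈ frechetSubdiff (ψ j) (u k j) := fun j hj k => by
    refine mem_frechetSubdiff_of_penalized_min (huS k) (hur k) (fun u' hu' hu'r => ?_) hj
    have := hopt k (w k) (hwC k) (hwr k) u' hu' hu'r
    simp only [hΦ] at this
    linarith
  -- Both iterates agree with `z` off `I`, so only coordinates in `I` need the horizon condition for
  -- boundedness.
  have hg0 : ∀ j ∉ I, ∀ k, g k j = 0 := fun j hj k => by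
    simp [hg, hCI _ (hwC k) j hj, huS k j hj]
  have hbd : ∀ j, ∃ R : ℝ, ∀ᶠ k in atTop, ‖g k j‖ ≤ R := fun j => by
    by_cases hj : j ∈ I
    · exact eventually_norm_le_of_horizonSubdiff_subset (hI j hj) (hulim j) (hψlim j) (hgI j hj)
    · exact ⟨0, Eventually.of_forall fun k => by simp [hg0 j hj k]⟩
  choose R hR using hbd
  have hbdd : Bornology.IsBounded {x : EuclideanSpace ℝ ι | ∀ j, ‖x j‖ ≤ R j} := by
    refine isBounded_iff_forall_norm_le.2 ⟨Real.sqrt (∑ j, R j ^ 2), fun x hx => ?_⟩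
    rw [EuclideanSpace.norm_eq]
    gcongr with j
    exact hx j
  obtain ⟨v, -, φ, hφ, hv⟩ := tendsto_subseq_of_frequently_bounded hbdd
    (x := g) (eventually_all.2 hR).frequently
  have hφt := hφ.tendsto_atTop
  refine ⟨v, fun j hj => ⟨fun k => u (φ k) j, fun k => g (φ k) j, (hulim j).comp hφt,
    (hψlim j).comp hφt, fun k => hgI j hj _,
    ((PiLp.continuous_apply 2 _ j).tendsto v).comp hv⟩, fun w' hw' => ?_⟩
  have hgrad : Continuous (gradient f) :=
    (InnerProductSpace.toDual ℝ _).symm.continuous.comp (hf.continuous_fderiv (by simp))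
  have hwφ := hw.comp hφt
  have hlim : Tendsto (fun k => inner ℝ (gradient f (w (φ k)) + g (φ k) +
      (2 : ℝ) • (w (φ k) - z)) (w' - w (φ k))) atTop
      (𝓝 (inner ℝ (gradient f z + v + (2 : ℝ) • (z - z)) (w' - z))) :=
    ((((hgrad.tendsto z).comp hwφ).add hv).add ((hwφ.sub_const z).const_smul 2)).inner
      (hwφ.const_sub w')
  rw [sub_self, smul_zero, add_zero] at hlim
  refine ge_of_tendsto' hlim fun k => ?_
  refine inner_nonneg_of_penalized_min hCc (hf.differentiable (by simp) _) (hwC _) (hwr _)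
    (fun x hx hxr => ?_) hw'
  have := hopt (φ k) x hx hxr (u (φ k)) (huS _) (hur _)
  linarith

end Optimality

/-! ### Lagrange multipliers by separation. -/

section Multipliers

/-- Lagrange multiplier for a linear inequality on a subspace under a Slater condition. -/
lemma exists_multiplier_of_slater {E F : Type*} [NormedAddCommGroup E] [InnerProductSpace ℝ E]
    [NormedAddCommGroup F] [InnerProductSpace ℝ F] [CompleteSpace F]
    (V : Submodule ℝ E) (A : E →ₗ[ℝ] F) {k₀ : F} {Q : Set F} (hQ : Convex ℝ Q)
    {d : E} (hdV : d ∈ V) (hd : k₀ + A d ∈ interior Q) {η : E}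
    (hη : ∀ h ∈ V, k₀ + A h ∈ Q → inner ℝ η h ≤ 0) :
    ∃ μ : F, (∀ κ ∈ Q, inner ℝ μ (κ - k₀) ≤ 0) ∧ ∀ h ∈ V, inner ℝ η h = inner ℝ μ (A h) := by
  have hconv : Convex ℝ ((fun h => (k₀ + A h, inner ℝ η h)) '' (V : Set E)) := by
    rintro _ ⟨x, hx, rfl⟩ _ ⟨y, hy, rfl⟩ s t hs ht hst
    refine ⟨s • x + t • y, V.add_mem (V.smul_mem _ hx) (V.smul_mem _ hy), ?_⟩
    refine Prod.ext ?_ ?_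
    · simp only [map_add, map_smul, Prod.fst_add, Prod.smul_fst, smul_add]
      have : k₀ = s • k₀ + t • k₀ := by rw [← add_smul, hst, one_smul]
      nth_rewrite 1 [this]
      abel
    · simp [inner_add_right, inner_smul_right]
  -- In `F × ℝ`, `hη` forbids an image point with first component in `Q` and a positive value of
  -- `⟪η, h⟫`. The separating functional `(g, τ)` will give `μ = -g / τ`.
  have hdisj : Disjoint (interior Q ×ˢ Set.Ioi (0 : ℝ))
      ((fun h => (k₀ + A h, inner ℝ η h)) '' (V : Set E)) := by
    rw [Set.disjoint_left]
    rintro _ ⟨h1, h2⟩ ⟨h, hh, rfl⟩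
    exact absurd (hη h hh (interior_subset h1)) (not_le.2 h2)
  have hsconv : Convex ℝ (interior Q ×ˢ Set.Ioi (0 : ℝ)) := hQ.interior.prod (convex_Ioi 0)
  have hopen : IsOpen (interior Q ×ˢ Set.Ioi (0 : ℝ)) := isOpen_interior.prod isOpen_Ioi
  obtain ⟨f, s, hf1, hf2⟩ : ∃ (f : StrongDual ℝ (F × ℝ)) (s : ℝ),
      (∀ a ∈ interior Q ×ˢ Set.Ioi (0 : ℝ), f a < s) ∧
      ∀ b ∈ (fun h => (k₀ + A h, inner ℝ η h)) '' (V : Set E), s ≤ f b :=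
    geometric_hahn_banach_open hsconv hopen hconv hdisj
  obtain ⟨g, τ, hfs⟩ : ∃ (g : F →L[ℝ] ℝ) (τ : ℝ), ∀ κ t, f (κ, t) = g κ + t * τ := by
    refine ⟨f.comp (ContinuousLinearMap.inl ℝ F ℝ), f (0, 1), fun κ t => ?_⟩
    have : ((κ, t) : F × ℝ) = (κ, 0) + t • (0, 1) := by simp
    rw [this, map_add, map_smul, smul_eq_mul]
    rfl
  have hcl : ∀ κ ∈ Q, ∀ t : ℝ, 0 ≤ t → g κ + t * τ ≤ s := by
    intro κ hκ t ht
    have hsub : closure (interior Q ×ˢ Set.Ioi (0 : ℝ)) ⊆ {p | f p ≤ s} :=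
      closure_minimal (fun p hp => (hf1 p hp).le) (isClosed_le f.continuous continuous_const)
    rw [← hfs]
    refine hsub ?_
    rw [closure_prod_eq, closure_Ioi,
      hQ.closure_interior_eq_closure_of_nonempty_interior ⟨_, hd⟩]
    exact ⟨subset_closure hκ, ht⟩
  have himg : ∀ h ∈ V, s ≤ g k₀ + g (A h) + inner ℝ η h * τ := by
    intro h hh
    have := hf2 _ ⟨h, hh, rfl⟩
    rwa [hfs, map_add] at this
  have hint : ∀ κ ∈ interior Q, g κ + τ < s := by
    intro κ hκ
    have := hf1 (κ, 1) ⟨hκ, Set.mem_Ioi.2 one_pos⟩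
    rwa [hfs, one_mul] at this
  clear hf1 hf2 hfs hconv hdisj
  -- A linear functional bounded below on a subspace is zero there.
  have hV : ∀ h ∈ V, g (A h) + inner ℝ η h * τ = 0 := by
    intro h hh
    by_contra hne0
    have := himg (((s - g k₀ - 1) / (g (A h) + inner ℝ η h * τ)) • h) (V.smul_mem _ hh)
    rw [map_smul, map_smul, inner_smul_right, smul_eq_mul, mul_assoc, add_assoc, ← mul_add,
      div_mul_cancel₀ _ hne0] at this
    linarith
  have hs0 : s ≤ g k₀ := by simpa using himg 0 V.zero_mem
  -- A positive `τ` contradicts the bound as `t → ∞`; `τ = 0` would give `g k₀ < s` at the Slater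
  -- point, against `hs0`.
  have hτ : τ < 0 := by
    have hnp : τ ≤ 0 := by
      by_contra! hpos
      have h3 := hcl (k₀ + A d) (interior_subset hd) (|s - g (k₀ + A d)| / τ + 1)
        (by positivity)
      rw [add_mul, div_mul_cancel₀ _ hpos.ne'] at h3
      linarith [le_abs_self (s - g (k₀ + A d))]
    refine lt_of_le_of_ne hnp fun h0 => ?_
    have h1 := hint _ hd
    have h3 := hV d hdV
    rw [h0, mul_zero, add_zero] at h3
    rw [map_add, h3, h0] at h1
    linarith
  have hμi : ∀ κ, inner ℝ ((-τ)⁻¹ • (InnerProductSpace.toDual ℝ F).symm g) κ = (-τ)⁻¹ * g κ :=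
    fun κ => by rw [real_inner_smul_left, InnerProductSpace.toDual_symm_apply]
  refine ⟨(-τ)⁻¹ • (InnerProductSpace.toDual ℝ F).symm g, fun κ hκ => ?_, fun h hh => ?_⟩
  · rw [hμi, map_sub]
    have := hcl κ hκ 0 le_rfl
    exact mul_nonpos_of_nonneg_of_nonpos (inv_nonneg.2 (by linarith)) (by linarith)
  · rw [hμi]
    have := hV h hh
    have h0 : -τ ≠ 0 := by linarith
    rw [inv_mul_eq_div, eq_div_iff h0]
    linarith

end Multipliers

/-! ### Affine maps and full row rank. -/

section Affine

variable {E F : Type*} [NormedAddCommGroup E] [NormedSpace ℝ E] [FiniteDimensional ℝ E]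
  [NormedAddCommGroup F] [NormedSpace ℝ F]

lemma hasFDerivAt_of_eq_linear_add {H : E → F} {L : E →ₗ[ℝ] F} {c : F}
    (h : ∀ x, H x = L x + c) (x : E) : HasFDerivAt H (LinearMap.toContinuousLinearMap L) x := by
  have : H = fun x => LinearMap.toContinuousLinearMap L x + c := funext h
  rw [this]
  exact (LinearMap.toContinuousLinearMap L).hasFDerivAt.add_const c

end Affine

lemma mulVec_surjective_of_linearIndependent_row {m n : Type*} [Fintype m] [Fintype n]
    {A : Matrix m n ℝ} (hA : LinearIndependent ℝ A.row) : Function.Surjective A.mulVec := by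
  have h1 : Module.finrank ℝ (LinearMap.range A.mulVecLin) = Module.finrank ℝ (m → ℝ) := by
    rw [Module.finrank_fintype_fun_eq_card]
    exact hA.rank_matrix
  exact LinearMap.range_eq_top.1 (Submodule.eq_top_of_finrank_eq h1)

/-! ### The affine maps `G` and `𝒰`, and the cone `𝒦` split into equalities and a conic part. -/

section BlockMaps

variable {m₁ m₂ n₁ s₁ n₂ s₂ K l₁ : ℕ} {l₂ : Fin K → ℕ}

/-- `stageOne` as a continuous linear map. -/
noncomputable def stageOneL : PSpace m₁ m₂ K →L[ℝ] EuclideanSpace ℝ (Fin m₁) :=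
  LinearMap.toContinuousLinearMap
    { toFun := stageOne, map_add' := fun _ _ => rfl, map_smul' := fun _ _ => rfl }

/-- `stageTwo` as a continuous linear map. -/
noncomputable def stageTwoL (i : Fin K) : PSpace m₁ m₂ K →L[ℝ] EuclideanSpace ℝ (Fin m₂) :=
  LinearMap.toContinuousLinearMap
    { toFun := fun z => stageTwo z i, map_add' := fun _ _ => rfl, map_smul' := fun _ _ => rfl }

/-- `eqOne` as a continuous linear map. -/
noncomputable def eqOneL : CSpace n₁ s₁ n₂ s₂ K →L[ℝ] EuclideanSpace ℝ (Fin n₁) :=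
  LinearMap.toContinuousLinearMap
    { toFun := eqOne, map_add' := fun _ _ => rfl, map_smul' := fun _ _ => rfl }

/-- `coneOne` as a continuous linear map. -/
noncomputable def coneOneL : CSpace n₁ s₁ n₂ s₂ K →L[ℝ] EuclideanSpace ℝ (Fin s₁) :=
  LinearMap.toContinuousLinearMap
    { toFun := coneOne, map_add' := fun _ _ => rfl, map_smul' := fun _ _ => rfl }

/-- `eqTwo` as a continuous linear map. -/
noncomputable def eqTwoL (i : Fin K) : CSpace n₁ s₁ n₂ s₂ K →L[ℝ] EuclideanSpace ℝ (Fin n₂) :=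
  LinearMap.toContinuousLinearMap
    { toFun := fun v => eqTwo v i, map_add' := fun _ _ => rfl, map_smul' := fun _ _ => rfl }

/-- `coneTwo` as a continuous linear map. -/
noncomputable def coneTwoL (i : Fin K) : CSpace n₁ s₁ n₂ s₂ K →L[ℝ] EuclideanSpace ℝ (Fin s₂) :=
  LinearMap.toContinuousLinearMap
    { toFun := fun v => coneTwo v i, map_add' := fun _ _ => rfl, map_smul' := fun _ _ => rfl }

lemma stageOne_add (x y : PSpace m₁ m₂ K) : stageOne (x + y) = stageOne x + stageOne y := rfl

lemma stageTwo_add (x y : PSpace m₁ m₂ K) (i : Fin K) :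
    stageTwo (x + y) i = stageTwo x i + stageTwo y i := rfl

lemma stageOne_smul (t : ℝ) (x : PSpace m₁ m₂ K) : stageOne (t • x) = t • stageOne x := rfl

lemma stageTwo_smul (t : ℝ) (x : PSpace m₁ m₂ K) (i : Fin K) :
    stageTwo (t • x) i = t • stageTwo x i := rfl

lemma stageOne_zero : stageOne (0 : PSpace m₁ m₂ K) = 0 := rfl

lemma stageTwo_zero (i : Fin K) : stageTwo (0 : PSpace m₁ m₂ K) i = 0 := rfl

namespace Problem

variable (D : Problem m₁ m₂ n₁ s₁ n₂ s₂ K l₁ l₂)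

/-- Linear part of the constraint mapping. -/
noncomputable def GLin : PSpace m₁ m₂ K →ₗ[ℝ] CSpace n₁ s₁ n₂ s₂ K where
  toFun z := D.G z - D.G 0
  map_add' x y := by
    ext (j | j | j | j) <;>
      simp only [G, stageOne_add, stageTwo_add, stageOne_zero, stageTwo_zero, map_add, map_zero,
        PiLp.sub_apply, PiLp.add_apply, PiLp.zero_apply, Sum.elim_inl, Sum.elim_inr] <;> ring
  map_smul' t x := by
    ext (j | j | j | j) <;>
      simp only [G, stageOne_smul, stageTwo_smul, stageOne_zero, stageTwo_zero, map_smul,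
        map_zero, PiLp.sub_apply, PiLp.add_apply, PiLp.smul_apply, PiLp.zero_apply,
        Sum.elim_inl, Sum.elim_inr, RingHom.id_apply, smul_eq_mul] <;> ring

lemma G_eq (z : PSpace m₁ m₂ K) : D.G z = D.GLin z + D.G 0 :=
  (sub_add_cancel (D.G z) (D.G 0)).symm

/-- Linear part of the inner mapping. -/
noncomputable def innerLin : PSpace m₁ m₂ K →ₗ[ℝ] USpace l₁ l₂ where
  toFun z := D.innerMap z - D.innerMap 0
  map_add' x y := by
    ext (j | j) <;>
      simp only [innerMap, stageOne_add, stageTwo_add, stageOne_zero, stageTwo_zero, map_add,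
        map_zero, PiLp.sub_apply, PiLp.add_apply, PiLp.zero_apply, Sum.elim_inl,
        Sum.elim_inr] <;> ring
  map_smul' t x := by
    ext (j | j) <;>
      simp only [innerMap, stageOne_smul, stageTwo_smul, stageOne_zero, stageTwo_zero, map_smul,
        map_zero, PiLp.sub_apply, PiLp.add_apply, PiLp.smul_apply, PiLp.zero_apply,
        Sum.elim_inl, Sum.elim_inr, RingHom.id_apply, smul_eq_mul] <;> ring

lemma innerMap_eq (z : PSpace m₁ m₂ K) : D.innerMap z = D.innerLin z + D.innerMap 0 :=
  (sub_add_cancel (D.innerMap z) (D.innerMap 0)).symm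

lemma nablaMap_G (z : PSpace m₁ m₂ K) : nablaMap D.G z =
    ContinuousLinearMap.adjoint (LinearMap.toContinuousLinearMap D.GLin) := by
  rw [nablaMap, (hasFDerivAt_of_eq_linear_add D.G_eq z).fderiv]

lemma nablaMap_innerMap (z : PSpace m₁ m₂ K) : nablaMap D.innerMap z =
    ContinuousLinearMap.adjoint (LinearMap.toContinuousLinearMap D.innerLin) := by
  rw [nablaMap, (hasFDerivAt_of_eq_linear_add D.innerMap_eq z).fderiv]

lemma innerLin_surjective (h₁ : LinearIndependent ℝ D.U₁.row)
    (h₂ : ∀ i, LinearIndependent ℝ (D.Uξ i).row) : Function.Surjective D.innerLin := by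
  intro t
  obtain ⟨x, hx⟩ := mulVec_surjective_of_linearIndependent_row h₁ (fun j => t (Sum.inl j))
  choose y hy using fun i =>
    mulVec_surjective_of_linearIndependent_row (h₂ i) (fun j => t (Sum.inr ⟨i, j⟩))
  refine ⟨WithLp.toLp 2 (Sum.elim x fun ij => y ij.1 ij.2), ?_⟩
  have e1 : stageOne (WithLp.toLp 2 (Sum.elim x fun ij => y ij.1 ij.2) : PSpace m₁ m₂ K) =
      WithLp.toLp 2 x := rfl
  have e2 : ∀ i, stageTwo (WithLp.toLp 2 (Sum.elim x fun ij => y ij.1 ij.2) :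
      PSpace m₁ m₂ K) i = WithLp.toLp 2 (y i) := fun i => rfl
  change D.innerMap _ - D.innerMap 0 = t
  ext (j | j)
  · simp only [innerMap, e1, stageOne_zero, map_zero, PiLp.sub_apply, PiLp.add_apply,
      PiLp.zero_apply, Sum.elim_inl]
    have := congrFun hx j
    simp [Matrix.toLpLin_apply, this]
  · simp only [innerMap, e2, stageTwo_zero, map_zero, PiLp.sub_apply, PiLp.add_apply,
      PiLp.zero_apply, Sum.elim_inr]
    have := congrFun (hy j.1) j.2
    simp [Matrix.toLpLin_apply, this]

lemma contDiff_fHat (hD : D.Standing) : ContDiff ℝ 1 D.fHat := by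
  have h1 : ContDiff ℝ 1 fun z : PSpace m₁ m₂ K => D.c (stageOne z) :=
    (hD.c_smooth.of_le (by norm_num)).comp stageOneL.contDiff
  have h2 : ∀ i, ContDiff ℝ 1 fun z : PSpace m₁ m₂ K => D.p i * D.qξ i (stageTwo z i) :=
    fun i => contDiff_const.mul (((hD.qξ_smooth i).of_le (by norm_num)).comp
      (stageTwoL i).contDiff)
  exact h1.add (ContDiff.sum fun i _ => h2 i)

/-- The conic part of the constraint set. -/
def conicPart : Set (CSpace n₁ s₁ n₂ s₂ K) :=
  {v | -coneOne v ∈ D.C₁ ∧ ∀ i, -coneTwo v i ∈ D.C₂ξ i}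

lemma conicPart_convex : Convex ℝ D.conicPart := by
  have h1 : Convex ℝ ((-coneOneL : CSpace n₁ s₁ n₂ s₂ K →L[ℝ] _) ⁻¹' (D.C₁ : Set _)) :=
    D.C₁.toPointedCone.convex.is_linear_preimage
      (-coneOneL : CSpace n₁ s₁ n₂ s₂ K →L[ℝ] _).isBoundedLinearMap.toIsLinearMap
  have h2 : ∀ i, Convex ℝ ((-coneTwoL i : CSpace n₁ s₁ n₂ s₂ K →L[ℝ] _) ⁻¹'
      (D.C₂ξ i : Set _)) := fun i => (D.C₂ξ i).toPointedCone.convex.is_linear_preimage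
      (-coneTwoL i : CSpace n₁ s₁ n₂ s₂ K →L[ℝ] _).isBoundedLinearMap.toIsLinearMap
  have : D.conicPart = ((-coneOneL : CSpace n₁ s₁ n₂ s₂ K →L[ℝ] _) ⁻¹' (D.C₁ : Set _)) ∩
      ⋂ i, ((-coneTwoL i : CSpace n₁ s₁ n₂ s₂ K →L[ℝ] _) ⁻¹' (D.C₂ξ i : Set _)) := by
    ext v
    simp only [Set.mem_inter_iff, Set.mem_iInter]
    rfl
  rw [this]
  exact h1.inter (convex_iInter h2)

lemma mem_cone_iff (v : CSpace n₁ s₁ n₂ s₂ K) :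
    v ∈ D.cone ↔ eqOne v = 0 ∧ (∀ i, eqTwo v i = 0) ∧ v ∈ D.conicPart := by
  simp only [cone, conicPart, Set.mem_ofPred_eq]
  tauto

lemma isClosed_cone : IsClosed D.cone := by
  have h1 : IsClosed {v : CSpace n₁ s₁ n₂ s₂ K | eqOne v = 0} :=
    isClosed_eq eqOneL.continuous continuous_const
  have h2 : ∀ i, IsClosed {v : CSpace n₁ s₁ n₂ s₂ K | eqTwo v i = 0} := fun i =>
    isClosed_eq (eqTwoL i).continuous continuous_const
  have h3 : IsClosed {v : CSpace n₁ s₁ n₂ s₂ K | -coneOne v ∈ D.C₁} :=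
    D.C₁.isClosed.preimage (coneOneL.continuous.neg)
  have h4 : ∀ i, IsClosed {v : CSpace n₁ s₁ n₂ s₂ K | -coneTwo v i ∈ D.C₂ξ i} := fun i =>
    (D.C₂ξ i).isClosed.preimage ((coneTwoL i).continuous.neg)
  have : D.cone = {v : CSpace n₁ s₁ n₂ s₂ K | eqOne v = 0} ∩
      ({v : CSpace n₁ s₁ n₂ s₂ K | -coneOne v ∈ D.C₁} ∩
      ((⋂ i, {v : CSpace n₁ s₁ n₂ s₂ K | eqTwo v i = 0}) ∩
      ⋂ i, {v : CSpace n₁ s₁ n₂ s₂ K | -coneTwo v i ∈ D.C₂ξ i})) := by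
    ext v
    simp [cone]
  rw [this]
  exact h1.inter (h3.inter ((isClosed_iInter h2).inter (isClosed_iInter h4)))

lemma convex_cone : Convex ℝ D.cone := by
  intro v hv w hw s t hs ht hst
  rw [mem_cone_iff] at hv hw ⊢
  refine ⟨?_, fun i => ?_, D.conicPart_convex hv.2.2 hw.2.2 hs ht hst⟩
  · change s • eqOne v + t • eqOne w = 0
    rw [hv.1, hw.1, smul_zero, smul_zero, add_zero]
  · change s • eqTwo v i + t • eqTwo w i = 0
    rw [hv.2.1, hw.2.1, smul_zero, smul_zero, add_zero]

lemma convex_feasible : Convex ℝ D.feasible := by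
  intro v hv w hw s t hs ht hst
  change D.G (s • v + t • w) ∈ D.cone
  have : D.G (s • v + t • w) = s • D.G v + t • D.G w := by
    have h0 : D.G 0 = s • D.G 0 + t • D.G 0 := by rw [← add_smul, hst, one_smul]
    rw [D.G_eq (s • v + t • w), D.G_eq v, D.G_eq w, map_add, map_smul, map_smul, smul_add,
      smul_add]
    nth_rewrite 1 [h0]
    abel
  rw [this]
  exact D.convex_cone hv hw hs ht hst

lemma continuous_G : Continuous D.G :=
  continuous_iff_continuousAt.2 fun z => (hasFDerivAt_of_eq_linear_add D.G_eq z).continuousAt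

lemma mem_interior_conicPart {v : CSpace n₁ s₁ n₂ s₂ K}
    (h₁ : coneOne v ∈ interior (-(D.C₁ : Set (EuclideanSpace ℝ (Fin s₁)))))
    (h₂ : ∀ i, coneTwo v i ∈ interior (-(D.C₂ξ i : Set (EuclideanSpace ℝ (Fin s₂))))) :
    v ∈ interior D.conicPart := by
  refine mem_interior_iff_mem_nhds.2 ?_
  have e1 := coneOneL.continuous.continuousAt.eventually_mem (x := v)
    (isOpen_interior.mem_nhds h₁)
  have e2 := eventually_all.2 fun i => (coneTwoL i).continuous.continuousAt.eventually_mem (x := v)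
    (isOpen_interior.mem_nhds (h₂ i))
  filter_upwards [e1, e2] with w hw1 hw2
  exact ⟨Set.mem_neg.1 (interior_subset hw1), fun i => Set.mem_neg.1 (interior_subset (hw2 i))⟩

/-- For an affine system the RCQ provides a Slater direction. -/
lemma RCQ.exists_slater {D : Problem m₁ m₂ n₁ s₁ n₂ s₂ K l₁ l₂} {E : Type*}
    [NormedAddCommGroup E] [InnerProductSpace ℝ E] [CompleteSpace E] [FiniteDimensional ℝ E]
    {H : E → CSpace n₁ s₁ n₂ s₂ K} {x : E} (h : D.RCQ H x) {L : E →ₗ[ℝ] CSpace n₁ s₁ n₂ s₂ K}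
    {c : CSpace n₁ s₁ n₂ s₂ K} (hH : ∀ w, H w = L w + c) :
    ∃ d, eqOne (L d) = 0 ∧ (∀ i, eqTwo (L d) i = 0) ∧ H x + L d ∈ interior D.conicPart := by
  obtain ⟨-, -, d, h1, h2, h3, h4⟩ := h
  have hd := hasFDerivAt_of_eq_linear_add hH x
  rw [show fderiv ℝ (fun w => eqOne (H w)) x = _ from (eqOneL.hasFDerivAt.comp x hd).fderiv] at h1
  rw [show fderiv ℝ (fun w => coneOne (H w)) x = _ from (coneOneL.hasFDerivAt.comp x hd).fderiv] at h3
  refine ⟨d, h1, fun i => ?_, D.mem_interior_conicPart h3 fun i => ?_⟩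
  · have := h2 i
    rwa [show fderiv ℝ (fun w => eqTwo (H w) i) x = _ from
      ((eqTwoL i).hasFDerivAt.comp x hd).fderiv] at this
  · have := h4 i
    rwa [show fderiv ℝ (fun w => coneTwo (H w) i) x = _ from
      ((coneTwoL i).hasFDerivAt.comp x hd).fderiv] at this

end Problem

end BlockMaps

/-! ### Freezing coordinates. -/

section Merge

variable {ι : Type*} (I : Set ι)

/-- Extension of a subvector by zero. -/
noncomputable def extendZero : EuclideanSpace ℝ I →ₗ[ℝ] EuclideanSpace ℝ ι where
  toFun := merge I 0
  map_add' x y := by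
    ext j
    by_cases h : j ∈ I <;> simp [merge, h]
  map_smul' t x := by
    ext j
    by_cases h : j ∈ I <;> simp [merge, h]

lemma extendZero_apply_of_notMem (w : EuclideanSpace ℝ I) {j : ι} (hj : j ∉ I) :
    extendZero I w j = 0 := by
  simp [extendZero, merge, hj]

lemma merge_eq (z : EuclideanSpace ℝ ι) (w : EuclideanSpace ℝ I) :
    merge I z w = extendZero I w + merge I z 0 := by
  ext j
  by_cases h : j ∈ I <;> simp [extendZero, merge, h]

lemma merge_restrict (z : EuclideanSpace ℝ ι) : merge I z (restrict I z) = z := by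
  ext j
  simp [restrict, merge]

end Merge

/-! ### Multipliers for the restricted problem, stationarity and KKT. -/

namespace Problem

variable {m₁ m₂ n₁ s₁ n₂ s₂ K l₁ : ℕ} {l₂ : Fin K → ℕ}
  {D : Problem m₁ m₂ n₁ s₁ n₂ s₂ K l₁ l₂}

-- The restricted system is affine with linear part `GLin ∘ extendZero`, so its Slater direction,
-- extended by zero, serves in the full space.
open Classical in
lemma RestrictedRCQ.exists_slater {I : Set (PIdx m₁ m₂ K)} {z : PSpace m₁ m₂ K}
    (h : D.RestrictedRCQ I z) :
    ∃ d : PSpace m₁ m₂ K, (∀ j ∉ I, d j = 0) ∧ eqOne (D.GLin d) = 0 ∧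
      (∀ i, eqTwo (D.GLin d) i = 0) ∧ D.G z + D.GLin d ∈ interior D.conicPart := by
  obtain ⟨d, h1, h2, h3⟩ := RCQ.exists_slater h (L := D.GLin ∘ₗ extendZero I)
    (c := D.G (merge I z 0)) (fun w => by
      rw [D.G_eq, merge_eq, map_add, D.G_eq (merge I z 0), LinearMap.comp_apply, add_assoc])
  rw [merge_restrict] at h3
  exact ⟨extendZero I d, fun j hj => extendZero_apply_of_notMem I d hj, h1, h2, h3⟩

open Classical in
/-- Normals to the restricted feasible set come from multipliers of the constraints and from the
fixed coordinates. -/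
lemma exists_multiplier {I : Set (PIdx m₁ m₂ K)} {z η : PSpace m₁ m₂ K}
    (hz : z ∈ D.feasible) (hRCQ : D.RestrictedRCQ I z)
    (hη : ∀ w ∈ D.feasible, (∀ j ∉ I, w j = z j) → inner ℝ η (w - z) ≤ 0) :
    ∃ M ∈ limitingNormalCone D.cone (D.G z), ∃ r : PSpace m₁ m₂ K, (∀ j ∈ I, r j = 0) ∧
      η = r + nablaMap D.G z M := by
  obtain ⟨d, hdI, hd1, hd2, hd3⟩ := hRCQ.exists_slater
  -- The common kernel of this finite family consists of the directions that preserve the equalities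
  -- and the frozen coordinates; indices in `I` carry the zero functional.
  set L : (Fin n₁ ⊕ (Fin K × Fin n₂)) ⊕ PIdx m₁ m₂ K → PSpace m₁ m₂ K →ₗ[ℝ] ℝ :=
    Sum.elim
      (Sum.elim (fun j => (EuclideanSpace.proj (Sum.inl j)).toLinearMap ∘ₗ D.GLin)
        (fun j => (EuclideanSpace.proj (Sum.inr (Sum.inr (Sum.inl j)))).toLinearMap ∘ₗ D.GLin))
      (fun j => if j ∈ I then 0 else (EuclideanSpace.proj j).toLinearMap) with hL
  have hmem : ∀ h : PSpace m₁ m₂ K, h ∈ ⨅ i, LinearMap.ker (L i) ↔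
      eqOne (D.GLin h) = 0 ∧ (∀ i, eqTwo (D.GLin h) i = 0) ∧ ∀ j ∉ I, h j = 0 := by
    intro h
    simp only [Submodule.mem_iInf, LinearMap.mem_ker]
    constructor
    · intro hh
      refine ⟨?_, fun i => ?_, fun j hj => ?_⟩
      · ext j
        exact hh (Sum.inl (Sum.inl j))
      · ext j
        exact hh (Sum.inl (Sum.inr (i, j)))
      · simpa [hL, hj] using hh (Sum.inr j)
    · rintro ⟨h1, h2, h3⟩ ((j | ⟨i, j⟩) | j)
      · exact congrArg (fun v : EuclideanSpace ℝ (Fin n₁) => v j) h1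
      · exact congrArg (fun v : EuclideanSpace ℝ (Fin n₂) => v j) (h2 i)
      · by_cases hj : j ∈ I
        · simp [hL, hj]
        · simpa [hL, hj] using h3 j hj
  have hzc := (D.mem_cone_iff _).1 hz
  obtain ⟨μ, hμ1, hμ2⟩ := exists_multiplier_of_slater (⨅ i, LinearMap.ker (L i)) D.GLin
    D.conicPart_convex ((hmem d).2 ⟨hd1, hd2, hdI⟩) hd3 (η := η) (fun h hh hc => by
      obtain ⟨h1, h2, h3⟩ := (hmem h).1 hh
      have hG : D.G (z + h) = D.G z + D.GLin h := by
        rw [D.G_eq (z + h), D.G_eq z, map_add]; abel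
      have hf : z + h ∈ D.feasible := by
        change D.G (z + h) ∈ D.cone
        rw [hG, mem_cone_iff]
        refine ⟨?_, fun i => ?_, hc⟩
        · change eqOne (D.G z) + eqOne (D.GLin h) = 0
          rw [hzc.1, h1, add_zero]
        · change eqTwo (D.G z) i + eqTwo (D.GLin h) i = 0
          rw [hzc.2.1, h2, add_zero]
      simpa using hη (z + h) hf fun j hj => by simp [h3 j hj])
  -- A functional that vanishes on a finite intersection of kernels is a combination of the family.
  -- Its coefficients give the equality multipliers `N` and the part `r` on the frozen coordinates.
  have hspan : (innerₛₗ ℝ η - innerₛₗ ℝ μ ∘ₗ D.GLin) ∈ Submodule.span ℝ (Set.range L) := by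
    refine mem_span_of_iInf_ker_le_ker fun h hh => ?_
    rw [LinearMap.mem_ker]
    exact sub_eq_zero.2 (hμ2 h hh)
  obtain ⟨c, hc⟩ := (Submodule.mem_span_range_iff_exists_fun ℝ).1 hspan
  set N : CSpace n₁ s₁ n₂ s₂ K := WithLp.toLp 2 (Sum.elim (fun j => c (Sum.inl (Sum.inl j)))
    (Sum.elim (fun _ => 0) (Sum.elim (fun j => c (Sum.inl (Sum.inr j))) (fun _ => 0)))) with hN
  set r : PSpace m₁ m₂ K := WithLp.toLp 2 fun j => if j ∈ I then 0 else c (Sum.inr j) with hr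
  have hNi : ∀ v : CSpace n₁ s₁ n₂ s₂ K, inner ℝ N v = ∑ j, c (Sum.inl (Sum.inl j)) * v (Sum.inl j)
      + ∑ j, c (Sum.inl (Sum.inr j)) * v (Sum.inr (Sum.inr (Sum.inl j))) := by
    intro v
    simp [PiLp.inner_apply, hN, mul_comm]
  refine ⟨μ + N, mem_limitingNormalCone_of_inner_nonpos hz fun w hw => ?_, r,
    fun j hj => by simp [hr, hj], ?_⟩
  · have hwc := (D.mem_cone_iff _).1 hw
    -- `N` lives on the equality blocks, which are zero throughout `𝒦`, so adding it keeps `μ`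
    -- normal.
    have h0 : inner ℝ N (w - D.G z) = 0 := by
      rw [hNi]
      have e1 : ∀ j, (w - D.G z) (Sum.inl j) = 0 := fun j => by
        have h1 := congrArg (fun v : EuclideanSpace ℝ (Fin n₁) => v j) hwc.1
        have h2 := congrArg (fun v : EuclideanSpace ℝ (Fin n₁) => v j) hzc.1
        exact (congrArg₂ (· - ·) h1 h2).trans (sub_zero _)
      have e2 : ∀ j, (w - D.G z) (Sum.inr (Sum.inr (Sum.inl j))) = 0 := fun ⟨i, j⟩ => by
        have h1 := congrArg (fun v : EuclideanSpace ℝ (Fin n₂) => v j) (hwc.2.1 i)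
        have h2 := congrArg (fun v : EuclideanSpace ℝ (Fin n₂) => v j) (hzc.2.1 i)
        exact (congrArg₂ (· - ·) h1 h2).trans (sub_zero _)
      simp only [e1, e2, mul_zero, Finset.sum_const_zero, add_zero]
    rw [inner_add_left, h0, add_zero]
    exact hμ1 w hwc.2.2
  · refine ext_inner_right ℝ fun h => ?_
    rw [inner_add_left, nablaMap_G, ContinuousLinearMap.adjoint_inner_left, inner_add_left,
      LinearMap.coe_toContinuousLinearMap', hNi]
    have h1 := LinearMap.congr_fun hc h
    have h2 : inner ℝ r h = ∑ j, c (Sum.inr j) * L (Sum.inr j) h := by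
      rw [PiLp.inner_apply]
      refine Finset.sum_congr rfl fun j _ => ?_
      by_cases hj : j ∈ I <;> simp [hr, hL, hj, mul_comm]
    rw [LinearMap.sum_apply, Fintype.sum_sum_type, Fintype.sum_sum_type] at h1
    simp only [LinearMap.smul_apply, smul_eq_mul, ← h2] at h1
    have h3 : (innerₛₗ ℝ η - innerₛₗ ℝ μ ∘ₗ D.GLin) h = inner ℝ η h - inner ℝ μ (D.GLin h) := rfl
    rw [h3] at h1
    have h4 : ∀ j, L (Sum.inl (Sum.inl j)) h = D.GLin h (Sum.inl j) := fun j => rfl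
    have h5 : ∀ j, L (Sum.inl (Sum.inr j)) h = D.GLin h (Sum.inr (Sum.inr (Sum.inl j))) :=
      fun j => rfl
    simp only [h4, h5] at h1
    linarith

lemma isStationary_of_isLocalMinimizer (hD : D.Standing) {ψ : PIdx m₁ m₂ K → ℝ → ℝ}
    (hψ : ∀ j, LowerSemicontinuous (ψ j)) (hsep : ∀ z, D.Psi z = ∑ j, ψ j (z j))
    {z : PSpace m₁ m₂ K} (hz : D.IsLocalMinimizer z)
    (hsub : ∀ j, j ∉ lipIndices ψ z → limitingSubdiff (ψ j) (z j) = Set.univ)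
    (hRCQ : D.RestrictedRCQ (lipIndices ψ z) z) : D.IsStationary z := by
  obtain ⟨hzf, hmin⟩ := hz
  have hPsi : D.Psi = fun w : PSpace m₁ m₂ K => ∑ j, ψ j (w j) := funext hsep
  rw [hPsi] at hmin
  set I := lipIndices ψ z with hI
  set C : Set (PSpace m₁ m₂ K) := D.feasible ∩ {w | ∀ j ∉ I, w j = z j} with hC
  have hset : {w : PSpace m₁ m₂ K | ∀ j ∉ I, w j = z j} = ⋂ j ∈ Iᶜ, {w | w j = z j} := by
    ext; simp
  have hCc : IsClosed C := by
    refine (D.isClosed_cone.preimage D.continuous_G).inter ?_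
    rw [hset]
    exact isClosed_biInter fun j _ =>
      isClosed_eq (PiLp.continuous_apply 2 _ j) continuous_const
  have hCconv : Convex ℝ C := by
    refine D.convex_feasible.inter fun v hv w hw s t _ _ hst j hj => ?_
    change s * v j + t * w j = z j
    rw [hv j hj, hw j hj, ← add_mul, hst, one_mul]
  obtain ⟨v, hvI, hvC⟩ := exists_subgradient_of_isLocalMinOn hψ (D.contDiff_fHat hD) hCc hCconv
    ⟨hzf, fun _ _ => rfl⟩ (fun w hw => hw.2) (fun j hj => Eq.subset hj)
    (hmin.on_subset Set.inter_subset_left)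
  obtain ⟨M, hM, r, hr, hη⟩ := exists_multiplier (η := -(gradient D.fHat z + v)) hzf hRCQ
    fun w hw hwI => by
      rw [inner_neg_left]
      linarith [hvC w ⟨hw, hwI⟩]
  refine ⟨hzf, v + r, ?_, M, hM, ?_⟩
  · rw [hPsi]
    refine mem_limitingSubdiff_sum fun j => ?_
    by_cases hj : j ∈ I
    · simpa [hr j hj] using hvI j hj
    · rw [hsub j hj]; trivial
  · rw [neg_eq_iff_eq_neg] at hη
    rw [← add_assoc, hη]
    abel

/-- Full row rank of all the blocks makes `innerLin` surjective, so the subgradient of `Ψ` lifts to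
a multiplier for `outerFun`. -/
lemma IsStationary.isKKT {z : PSpace m₁ m₂ K} (h : D.IsStationary z)
    (h₁ : LinearIndependent ℝ D.U₁.row) (h₂ : ∀ i, LinearIndependent ℝ (D.Uξ i).row) :
    D.IsKKT z := by
  obtain ⟨hz, v, hv, M, hM, h0⟩ := h
  have hPsi : D.Psi = fun x => D.outerFun (LinearMap.toContinuousLinearMap D.innerLin x +
      D.innerMap 0) := funext fun x => congrArg D.outerFun (D.innerMap_eq x)
  rw [hPsi] at hv
  obtain ⟨lam, hlam, hlamv⟩ := exists_mem_limitingSubdiff_of_comp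
    (D.innerLin_surjective h₁ h₂) hv
  refine ⟨hz, lam, ?_, M, hM, ?_⟩
  · rw [D.innerMap_eq z]; exact hlam
  · rw [nablaMap_innerMap, hlamv]; exact h0

end Problem

end TwoStage

theorem mainTheorem5 {m₁ m₂ n₁ s₁ n₂ s₂ K l₁ : ℕ} {l₂ : Fin K → ℕ}
    (D : TwoStage.Problem m₁ m₂ n₁ s₁ n₂ s₂ K l₁ l₂) (hD : D.Standing)
    (ψ : TwoStage.PIdx m₁ m₂ K → ℝ → ℝ)
    (hψ : ∀ j, LowerSemicontinuous (ψ j))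
    (hsep : ∀ z : TwoStage.PSpace m₁ m₂ K, D.Psi z = ∑ j, ψ j (z j))
    (z : TwoStage.PSpace m₁ m₂ K)
    (hz : D.IsLocalMinimizer z)
    (hsub : ∀ j, j ∉ TwoStage.lipIndices ψ z →
      TwoStage.limitingSubdiff (ψ j) (z j) = Set.univ)
    (hRCQ : D.RestrictedRCQ (TwoStage.lipIndices ψ z) z) :
    D.IsStationary z ∧
    (LinearIndependent ℝ D.U₁.row → (∀ i, LinearIndependent ℝ (D.Uξ i).row) → D.IsKKT z) :=
  have h := TwoStage.Problem.isStationary_of_isLocalMinimizer hD hψ hsep hz hsub hRCQ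
  ⟨h, h.isKKT⟩
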